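/- Let $M=(|M|,\mathcal O_M)$ be a smooth real supermanifold of dimension $n|m$ (a Hausdorff second countable space with a sheaf of supercommutative $\mathbb R$-algebras that is locally isomorphic to $(\mathbb R^n, C^\infty(\mathbb R^n)\otimes\Lambda(\xi^1,\dots,\xi^m))$), and let $Q$ be a homological vector field on $M$, i.e. an odd vector field (an odd derivation of the structure sheaf) with $Q^2=0$. A Berezin form is a section $\mathbf s$ of the Berezin bundle: in local coordinates $x=(x^a)$ it is $\mathbf s=D[x]\,s(x)$, where $D[x']=D[x]\,\mathrm{Ber}(\partial x'/\partial x)$ under a change of coordinates. A Berezin volume is an even Berezin form $\boldsymbol\rho=D[x]\,\rho(x)$ that vanishes nowhere ($\rho$ is invertible). For $\boldsymbol\rho$ a Berezin volume, let $L_Q\boldsymbol\rho$ be the Berezin form with local expression $D[x]\sum_a\partial(Q^a\rho)/\partial x^a$, where $Q=Q^a\,\partial/\partial x^a$, and let $\mathrm{Div}_{\boldsymbol\rho}Q$ be the function with $\boldsymbol\rho\,\mathrm{Div}_{\boldsymbol\rho}Q=L_Q\boldsymbol\rho$. Then: 1. For every Berezin volume $\boldsymbol\rho$, $L_Q\boldsymbol\rho$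 is a well-defined Berezin form, and $\mathrm{Div}_{\boldsymbol\rho}Q\in C^\infty(M)$ exists, is unique, is odd, and satisfies $Q(\mathrm{Div}_{\boldsymbol\rho}Q)=0$. 2. For every Berezin volume $\boldsymbol\rho$ and every even $g\in C^\infty(M)$, the exponential $\exp(g)\in C^\infty(M)$ is well defined, $\exp(g)\boldsymbol\rho$ is a Berezin volume, and $\mathrm{Div}_{\exp(g)\boldsymbol\rho}Q=\mathrm{Div}_{\boldsymbol\rho}Q+Q(g)$. 3. Suppose that $M$ has a Berezin volume. Then the class of $\mathrm{Div}_{\boldsymbol\rho}Q$ in the odd part of the standard cohomology of $(M,Q)$, i.e. of the cohomology of the $\mathbb Z/2$-graded complex $(C^\infty(M),Q)$, is the same for all Berezin volumes $\boldsymbol\rho$. Hence the modular class $\mathrm{Mod}(Q)=[\mathrm{Div}_{\boldsymbol\rho}Q]$ is well defined. -/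

import Mathlib

open scoped Manifold ContDiff TensorProduct
open CategoryTheory TopologicalSpace Opposite

universe u

namespace Super

noncomputable section

/-! ### The local model: superdomains of dimension `n|m` -/

/-- The Euclidean space `ℝⁿ`. -/
abbrev Euc (n : ℕ) : Type := EuclideanSpace ℝ (Fin n)

/-- The algebra `C^∞(V)` of real-valued smooth functions on an open set `V ⊆ ℝⁿ`. -/
abbrev Smooth {n : ℕ} (V : Opens (Euc n)) : Type := C^∞⟮𝓘(ℝ, Euc n), V; 𝓘(ℝ, ℝ), ℝ⟯

/-- The Grassmann algebra `Λ(ξ¹, …, ξᵐ)`. -/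
abbrev Grassmann (m : ℕ) : Type := ExteriorAlgebra ℝ (Fin m → ℝ)

/-- The algebra `C^∞(V) ⊗ Λ(ξ¹, …, ξᵐ)` of superfunctions on the superdomain over `V ⊆ ℝⁿ`. -/
abbrev Model {n : ℕ} (m : ℕ) (V : Opens (Euc n)) : Type := Smooth V ⊗[ℝ] Grassmann m

/-- Restriction of smooth functions to a smaller open set. -/
def Smooth.res {n : ℕ} {V W : Opens (Euc n)} (h : W ≤ V) : Smooth V →ₐ[ℝ] Smooth W where
  __ := ContMDiffMap.restrictRingHom 𝓘(ℝ, Euc n) 𝓘(ℝ, ℝ) ℝ h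
  commutes' _ := rfl

/-- Restriction of superfunctions to a smaller open set. -/
def Model.res {n m : ℕ} {V W : Opens (Euc n)} (h : W ≤ V) : Model m V →ₐ[ℝ] Model m W :=
  Algebra.TensorProduct.map (Smooth.res h) (AlgHom.id ℝ (Grassmann m))

/-- The homogeneous superfunctions of parity `i`, i.e. `C^∞(V) ⊗ Λⁱ` with
`Λ = Λ⁰ ⊕ Λ¹` the decomposition of the Grassmann algebra into its even and its odd part. -/
def Model.grading {n m : ℕ} (V : Opens (Euc n)) (i : ZMod 2) : Submodule ℝ (Model m V) :=
  LinearMap.range (LinearMap.lTensor (Smooth V)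
    (CliffordAlgebra.evenOdd (0 : QuadraticForm ℝ (Fin m → ℝ)) i).subtype)

theorem contMDiff_iff_extend {n : ℕ} {V : Opens (Euc n)} (f : V → ℝ) :
    ContMDiff 𝓘(ℝ, Euc n) 𝓘(ℝ, ℝ) ∞ f ↔
      ContDiffOn ℝ ∞ (Function.extend Subtype.val f (0 : Euc n → ℝ)) (V : Set (Euc n)) := by
  have hf : f = fun x : V => Function.extend Subtype.val f (0 : Euc n → ℝ) (x : Euc n) := by
    funext x
    exact (Subtype.val_injective.extend_apply f (0 : Euc n → ℝ) x).symm
  constructor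
  · intro h x hx
    have h1 := h ⟨x, hx⟩
    rw [hf, contMDiffAt_subtype_iff (x := (⟨x, hx⟩ : V)), contMDiffAt_iff_contDiffAt] at h1
    exact h1.contDiffWithinAt
  · intro h x
    rw [hf, contMDiffAt_subtype_iff, contMDiffAt_iff_contDiffAt]
    exact (h x x.2).contDiffAt (V.isOpen.mem_nhds x.2)

/-- The partial derivative `∂f/∂x^μ` of a smooth function on an open set of `ℝⁿ`. -/
def Smooth.partialDeriv {n : ℕ} (V : Opens (Euc n)) (μ : Fin n) : Smooth V →ₗ[ℝ] Smooth V where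
  toFun f :=
    ⟨fun x => fderiv ℝ (Function.extend Subtype.val f (0 : Euc n → ℝ)) (x : Euc n)
        (EuclideanSpace.single μ (1 : ℝ)), by
      rw [contMDiff_iff_extend]
      have hf := (contMDiff_iff_extend (f : V → ℝ)).1 f.contMDiff
      refine ((hf.fderiv_of_isOpen V.isOpen (m := ∞) (by simp)).clm_apply
        (contDiffOn_const (c := EuclideanSpace.single μ (1 : ℝ)))).congr ?_
      intro x hx
      exact Subtype.val_injective.extend_apply _ (0 : Euc n → ℝ) (⟨x, hx⟩ : V)⟩
  map_add' f g := by
    ext x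
    have hd (k : Smooth V) : DifferentiableAt ℝ (Function.extend Subtype.val k (0 : Euc n → ℝ)) (x : Euc n) :=
      (((contMDiff_iff_extend (k : V → ℝ)).1 k.contMDiff).contDiffAt
        (V.isOpen.mem_nhds x.2)).differentiableAt (by simp)
    have hadd : Function.extend Subtype.val (f + g : Smooth V) (0 : Euc n → ℝ)
        = Function.extend Subtype.val f (0 : Euc n → ℝ) +
          Function.extend Subtype.val g (0 : Euc n → ℝ) := by
      rw [← Function.extend_add, add_zero]
      rfl
    change fderiv ℝ (Function.extend Subtype.val (f + g : Smooth V) (0 : Euc n → ℝ)) _ _ = _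
    rw [hadd, fderiv_add (hd f) (hd g)]
    rfl
  map_smul' c f := by
    ext x
    have hsm : Function.extend Subtype.val (c • f : Smooth V) (0 : Euc n → ℝ)
        = c • Function.extend Subtype.val f (0 : Euc n → ℝ) := by
      rw [← Function.extend_smul, smul_zero]
      rfl
    change fderiv ℝ (Function.extend Subtype.val (c • f : Smooth V) (0 : Euc n → ℝ)) _ _ = _
    rw [hsm, fderiv_const_smul_field]
    rfl

/-- The coordinate function `x^μ` on an open set of `ℝⁿ`. -/
def Smooth.coord {n : ℕ} (V : Opens (Euc n)) (μ : Fin n) : Smooth V :=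
  ⟨fun x => (x : Euc n) μ, by
    have h : ContMDiff 𝓘(ℝ, Euc n) 𝓘(ℝ, ℝ) ∞ (EuclideanSpace.proj μ : Euc n →L[ℝ] ℝ) :=
      (EuclideanSpace.proj μ : Euc n →L[ℝ] ℝ).contMDiff
    exact h.comp contMDiff_subtype_val⟩

/-- The pointwise exponential of a smooth function. -/
def Smooth.exp {n : ℕ} {V : Opens (Euc n)} (f : Smooth V) : Smooth V :=
  ⟨fun x => Real.exp (f x), Real.contDiff_exp.contMDiff.comp f.contMDiff⟩

/-- The parity of a coordinate: `0` for `x^μ`, `1` for `ξ^i`. -/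
def parity {n m : ℕ} : Fin n ⊕ Fin m → ZMod 2 :=
  Sum.elim (fun _ => 0) (fun _ => 1)

/-- The standard coordinates `(x^μ, ξ^i)` on a superdomain. -/
def Model.coord {n m : ℕ} (V : Opens (Euc n)) : Fin n ⊕ Fin m → Model m V :=
  Sum.elim (fun μ => Smooth.coord V μ ⊗ₜ[ℝ] (1 : Grassmann m))
    (fun i => (1 : Smooth V) ⊗ₜ[ℝ] ExteriorAlgebra.ι ℝ (Pi.single i (1 : ℝ)))

/-- The (left) partial derivatives `∂/∂x^μ` and `∂/∂ξ^i` on a superdomain. The latter is the odd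
derivation of the Grassmann algebra with `∂ξ^j/∂ξ^i = δ_i^j`. -/
def Model.pd {n m : ℕ} (V : Opens (Euc n)) : Fin n ⊕ Fin m → (Model m V →ₗ[ℝ] Model m V) :=
  Sum.elim (fun μ => LinearMap.rTensor (Grassmann m) (Smooth.partialDeriv V μ))
    (fun i => LinearMap.lTensor (Smooth V)
      (CliffordAlgebra.contractLeft (Q := (0 : QuadraticForm ℝ (Fin m → ℝ)))
        (LinearMap.proj i : (Fin m → ℝ) →ₗ[ℝ] ℝ)))

/-- The body of a superfunction: set all `ξ^i` equal to zero. -/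
def Model.body {n m : ℕ} (V : Opens (Euc n)) : Model m V →ₐ[ℝ] Smooth V :=
  (Algebra.TensorProduct.rid ℝ ℝ (Smooth V)).toAlgHom.comp
    (Algebra.TensorProduct.map (AlgHom.id ℝ (Smooth V)) ExteriorAlgebra.algebraMapInv)

/-- The exponential of a superfunction `g = g₀ + ν` with body `g₀` and nilpotent part `ν`
(for `g` even, `ν ^ (m + 1) = 0`): `exp g = exp(g₀) ∑_{k ≤ m} ν ^ k / k!`. -/
def Model.exp {n m : ℕ} {V : Opens (Euc n)} (g : Model m V) : Model m V :=
  (Smooth.exp (Model.body V g) ⊗ₜ[ℝ] (1 : Grassmann m)) *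
    ∑ k ∈ Finset.range (m + 1),
      ((k.factorial : ℝ)⁻¹) • (g - Model.body V g ⊗ₜ[ℝ] (1 : Grassmann m)) ^ k

/-! ### Supermanifolds -/

/-- A superringed space over `ℝ`: a topological space with a sheaf of supercommutative
`ℤ/2`-graded real algebras. -/
structure SuperSpace where
  space : TopCat.{u}
  sheaf : TopCat.Sheaf (AlgCat.{u} ℝ) space
  grading : ∀ U : Opens space, ZMod 2 → Submodule ℝ (sheaf.obj.obj (op U))
  graded : ∀ U : Opens space, GradedAlgebra (grading U)
  map_mem : ∀ {U V : Opens space} (h : V ≤ U) (i : ZMod 2) (f : sheaf.obj.obj (op U)),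
    f ∈ grading U i → (sheaf.obj.map (homOfLE h).op).hom f ∈ grading V i
  supercomm : ∀ (U : Opens space) (i j : ZMod 2) (f g : sheaf.obj.obj (op U)),
    f ∈ grading U i → g ∈ grading U j → f * g = ((-1 : ℤˣ) ^ (i * j)) • (g * f)

namespace SuperSpace

variable (M : SuperSpace.{u})

instance (U : Opens M.space) : GradedAlgebra (M.grading U) := M.graded U

/-- The algebra `𝒪_M(U)`. -/
abbrev Fn (U : Opens M.space) : Type u := M.sheaf.obj.obj (op U)

/-- The restriction `𝒪_M(U) → 𝒪_M(V)`, for `V ⊆ U`. -/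
def res {U V : Opens M.space} (h : V ≤ U) : M.Fn U →ₐ[ℝ] M.Fn V :=
  (M.sheaf.obj.map (homOfLE h).op).hom

/-- The subalgebra of even elements of `𝒪_M(U)`. -/
abbrev evenPart (U : Opens M.space) : Subalgebra ℝ (M.Fn U) :=
  SetLike.GradeZero.subalgebra (M.grading U)

instance (U : Opens M.space) : CommRing (M.evenPart U) where
  mul_comm a b := Subtype.ext (by
    have h := M.supercomm U 0 0 a b a.2 b.2
    simpa using h)

/-- The even component of a section. -/
def evenComponent {U : Opens M.space} (f : M.Fn U) : M.evenPart U :=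
  DirectSum.decompose (M.grading U) f 0

/-- The Berezinian (superdeterminant) `det(A - B D⁻¹ C) det(D)⁻¹` of an even supermatrix with
blocks `A`, `D` (even entries) and `B`, `C` (odd entries). Since the entries of `A`, `D` and
`A - B D⁻¹ C` are even, passing to even components only serves to view these as matrices
over the commutative ring of even sections. -/
def berezinian {n m : ℕ} {U : Opens M.space}
    (J : Matrix (Fin n ⊕ Fin m) (Fin n ⊕ Fin m) (M.Fn U)) : M.Fn U :=
  let Dinv : Matrix (Fin m) (Fin m) (M.evenPart U) := (J.toBlocks₂₂.map M.evenComponent)⁻¹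
  let S : Matrix (Fin n) (Fin n) (M.Fn U) :=
    J.toBlocks₁₁ - J.toBlocks₁₂ * Dinv.map Subtype.val * J.toBlocks₂₁
  (((S.map M.evenComponent).det * Dinv.det : M.evenPart U) : M.Fn U)

/-- A chart of dimension `n|m`: an isomorphism of superringed spaces from an open part of `M` onto
an open part of `ℝ^{n|m}`. -/
structure Chart (n m : ℕ) where
  toHomeo : OpenPartialHomeomorph M.space (Euc n)
  iso : ∀ W : Opens M.space, ∀ hW : (W : Set M.space) ⊆ toHomeo.source,
    M.Fn W ≃ₐ[ℝ] Model m
      (⟨toHomeo '' W, toHomeo.isOpen_image_of_subset_source W.isOpen hW⟩ : Opens (Euc n))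
  iso_res : ∀ (W W' : Opens M.space) (hW : (W : Set M.space) ⊆ toHomeo.source)
    (h : W' ≤ W) (f : M.Fn W),
    iso W' (fun _ hx => hW (h hx)) (M.res h f) = Model.res (Set.image_mono h) (iso W hW f)
  iso_mem : ∀ (W : Opens M.space) (hW : (W : Set M.space) ⊆ toHomeo.source) (i : ZMod 2)
    (f : M.Fn W), f ∈ M.grading W i ↔ iso W hW f ∈ Model.grading _ i

namespace Chart

variable {M} {n m : ℕ} (φ : M.Chart n m)

/-- The domain of a chart, as an open set. -/
def dom : Opens M.space := ⟨φ.toHomeo.source, φ.toHomeo.open_source⟩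

/-- The local coordinates `x^a = (x^μ, ξ^i)` of a chart, as sections over `W ⊆ dom φ`. -/
def coord (W : Opens M.space) (hW : W ≤ φ.dom) (a : Fin n ⊕ Fin m) : M.Fn W :=
  (φ.iso W hW).symm (Model.coord _ a)

/-- The partial derivatives `∂/∂x^a` of a chart, acting on sections over `W ⊆ dom φ`. -/
def pd (W : Opens M.space) (hW : W ≤ φ.dom) (a : Fin n ⊕ Fin m) : M.Fn W →ₗ[ℝ] M.Fn W :=
  (φ.iso W hW).symm.toLinearMap ∘ₗ Model.pd _ a ∘ₗ (φ.iso W hW).toLinearMap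

/-- The Jacobian matrix `(∂x'^b/∂x^a)`, with row index `a` and column index `b`, of the change from
the coordinates `x` of `φ` to the coordinates `x'` of `ψ`. -/
def jacobian (ψ : M.Chart n m) :
    Matrix (Fin n ⊕ Fin m) (Fin n ⊕ Fin m) (M.Fn (φ.dom ⊓ ψ.dom)) :=
  Matrix.of fun a b => φ.pd _ inf_le_left a (ψ.coord _ inf_le_right b)

end Chart

end SuperSpace

/-- A supermanifold of dimension `n|m`: a superringed space which is locally isomorphic to
`ℝ^{n|m}`, with Hausdorff and second countable underlying space. -/
structure Supermanifold (n m : ℕ) extends SuperSpace.{u} where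
  t2 : T2Space space
  secondCountable : SecondCountableTopology space
  exists_chart : ∀ p : space, ∃ φ : toSuperSpace.Chart n m, p ∈ φ.dom

/-! ### Vector fields and the standard cohomology -/

/-- A homogeneous vector field of parity `p`: a section of the tangent sheaf, i.e. a derivation of
parity `p` of the structure sheaf. -/
structure VectorField (M : SuperSpace.{u}) (p : ZMod 2) where
  app : ∀ U : Opens M.space, M.Fn U →ₗ[ℝ] M.Fn U
  app_res : ∀ {U V : Opens M.space} (h : V ≤ U) (f : M.Fn U),
    app V (M.res h f) = M.res h (app U f)
  app_mem : ∀ (U : Opens M.space) (i : ZMod 2) (f : M.Fn U),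
    f ∈ M.grading U i → app U f ∈ M.grading U (i + p)
  leibniz : ∀ (U : Opens M.space) (i : ZMod 2) (f g : M.Fn U), f ∈ M.grading U i →
    app U (f * g) = app U f * g + ((-1 : ℤˣ) ^ (p * i)) • (f * app U g)

/-- A homological vector field (Q-structure): an odd vector field `Q` with `Q² = 0`. -/
structure HomologicalVectorField (M : SuperSpace.{u}) extends VectorField M 1 where
  sq_zero : ∀ (U : Opens M.space) (f : M.Fn U), app U (app U f) = 0

namespace HomologicalVectorField

variable {M : SuperSpace.{u}} (Q : HomologicalVectorField M)

/-- The `Q`-closed global functions of parity `i`. -/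
def cocycles (i : ZMod 2) : Submodule ℝ (M.Fn ⊤) :=
  M.grading ⊤ i ⊓ LinearMap.ker (Q.app ⊤)

/-- The `Q`-exact global functions of parity `i`. -/
def coboundaries (i : ZMod 2) : Submodule ℝ (M.Fn ⊤) :=
  (M.grading ⊤ (i + 1)).map (Q.app ⊤)

/-- The parity `i` part of the standard cohomology, i.e. of the cohomology of the
`ℤ/2`-graded complex `(C^∞(M), Q)`. -/
abbrev StdCohomology (i : ZMod 2) : Type u :=
  Q.cocycles i ⧸ (Q.coboundaries i).submoduleOf (Q.cocycles i)

end HomologicalVectorField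

/-! ### Berezin forms, volumes and the divergence -/

namespace Supermanifold

variable {n m : ℕ} (M : Supermanifold.{u} n m)

/-- A Berezin form, i.e. a global section `s` of the Berezin bundle: in every chart it is
`D[x] s(x)`, where `D[x'] = D[x] Ber(∂x'/∂x)` under a change of coordinates. -/
structure BerezinForm where
  coeff : ∀ φ : M.toSuperSpace.Chart n m, M.Fn φ.dom
  transform : ∀ φ ψ : M.toSuperSpace.Chart n m,
    M.res (inf_le_left : φ.dom ⊓ ψ.dom ≤ φ.dom) (coeff φ) =
      M.berezinian (φ.jacobian ψ) * M.res (inf_le_right : φ.dom ⊓ ψ.dom ≤ ψ.dom) (coeff ψ)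

/-- A Berezin volume: a nowhere vanishing even Berezin form. -/
structure BerezinVolume extends BerezinForm M where
  even : ∀ φ, coeff φ ∈ M.grading φ.dom 0
  isUnit : ∀ φ, IsUnit (coeff φ)

variable {M}

/-- The coefficient of `L_X s` in the chart `φ`, for a vector field `X = X^a ∂/∂x^a` of parity `p`:
`∑_a (-1)^{|a|(p + 1)} ∂(X^a s)/∂x^a`, where `X^a = X(x^a)`. -/
def lieCoeff {p : ZMod 2} (X : VectorField M.toSuperSpace p) (s : BerezinForm M)
    (φ : M.toSuperSpace.Chart n m) : M.Fn φ.dom :=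
  ∑ a : Fin n ⊕ Fin m, ((-1 : ℤˣ) ^ (parity a * (p + 1))) •
    φ.pd φ.dom le_rfl a (X.app φ.dom (φ.coord φ.dom le_rfl a) * s.coeff φ)

/-- `σ = L_X s` is the Lie derivative of the Berezin form `s` along `X`. -/
def IsLieDerivative {p : ZMod 2} (X : VectorField M.toSuperSpace p) (s σ : BerezinForm M) : Prop :=
  ∀ φ, σ.coeff φ = lieCoeff X s φ

/-- `f` is the divergence of `X` with respect to `ρ`, i.e. `ρ f = L_X ρ`. -/
def IsDivergence {p : ZMod 2} (ρ : BerezinVolume M) (X : VectorField M.toSuperSpace p)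
    (f : M.Fn ⊤) : Prop :=
  ∃ σ : BerezinForm M, IsLieDerivative X ρ.toBerezinForm σ ∧
    ∀ φ, ρ.coeff φ * M.res le_top f = σ.coeff φ

/-- The divergence `Div_ρ X`: the function `f` on `M` with `ρ f = L_X ρ`
(with a junk value if there were none). -/
def divergence {p : ZMod 2} (ρ : BerezinVolume M) (X : VectorField M.toSuperSpace p) : M.Fn ⊤ :=
  Classical.epsilon (IsDivergence ρ X)

/-- `h` is the exponential `exp(g)` of the function `g`. -/
def IsExp (g h : M.Fn ⊤) : Prop :=
  ∀ φ : M.toSuperSpace.Chart n m,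
    φ.iso φ.dom le_rfl (M.res le_top h) = Model.exp (φ.iso φ.dom le_rfl (M.res le_top g))

/-- `ρ' = h ρ`, for a function `h`. -/
def IsMul (h : M.Fn ⊤) (ρ ρ' : BerezinVolume M) : Prop :=
  ∀ φ, ρ'.coeff φ = M.res le_top h * ρ.coeff φ

end Supermanifold

end

end Super

namespace Super

/-! ### Hadamard's lemma -/

section Hadamard

open MeasureTheory intervalIntegral

/-! For odd Q the signs in L_Q cancel: with d = ∑ ∂Q^a/∂x^a, the coefficient of L_Q ρ in a chart is
dρ + Q(ρ) (`sum_pd_mul`, `lieCoeff_eq`). The theorem then reduces to how d changes with the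
coordinates and to Q(d) = 0.

Change of coordinates. Passing from x to x' adds to d the sum of (-1)^{|c|} (∂x^c/∂x'^b)
Q(∂x'^b/∂x^c) over b and c (`coordDiv_eq`). By a super version of Jacobi's formula this same sum is
the logarithmic derivative of the Berezinian along Q (`IsEvenPart.deriv_ber`). Hence L_Q ρ is a
Berezin form (`lieCoeff_transform`). The local quotients of L_Q ρ by the invertible ρ glue to a
unique function f, the divergence.

Closedness. Up to sign, Q(d) is the supertrace of the square of the odd supermatrix (∂_b Q^a), which
vanishes (`map_coordDiv`). Since Q(ρ) = ρ(f - d) with f - d odd, hence of square zero, Q²(ρ) = 0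
leaves ρ Q(f) = 0.

Dependence on ρ. If ρ' = hρ with h even and Q(h) = Q(g)h, the divergence changes by Q(g)
(`divergence_of_isMul`). This applies to h = exp(g). Conversely, two volumes differ by an even
invertible h, and g = log|h| is globally defined, so the class does not change. The chart formulas
for exp and log glue because a superfunction is determined by its values and its odd derivatives
(`ext_val_pd`), and values do not depend on the chart (`val_eq_val`).

Underneath lies the chain rule D f = ∑ D(x^a) ∂_a f for every algebraic superderivation D
(`Model.derivation_eq_sum`). It follows from Hadamard's lemma at each point and an induction over
Grassmann generators. -/

theorem hasFDerivAt_integral_of_contDiff {E G : Type*} [NormedAddCommGroup E] [NormedSpace ℝ E]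
    [FiniteDimensional ℝ E] [NormedAddCommGroup G] [NormedSpace ℝ G] [CompleteSpace G]
    {f : E × ℝ → G} (hf : ContDiff ℝ ∞ f) (x : E) :
    HasFDerivAt (fun x => ∫ t in (0 : ℝ)..1, f (x, t))
      (∫ t in (0 : ℝ)..1, (fderiv ℝ f (x, t)).comp (ContinuousLinearMap.inl ℝ E ℝ)) x := by
  have hc : Continuous fun q : E × ℝ =>
      (fderiv ℝ f q).comp (ContinuousLinearMap.inl ℝ E ℝ) :=
    (hf.continuous_fderiv (by simp)).clm_comp continuous_const
  -- A constant dominating the derivative on the compact set (closed unit ball around x) × [0, 1]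
  -- suffices for differentiation under the integral.
  obtain ⟨C, hC⟩ := (((isCompact_closedBall x 1).prod (isCompact_Icc (a := (0 : ℝ)) (b := 1))).image
    hc.norm).bddAbove
  refine hasFDerivAt_integral_of_dominated_of_fderiv_le
    (F' := fun y t => (fderiv ℝ f (y, t)).comp (ContinuousLinearMap.inl ℝ E ℝ))
    (bound := fun _ => C) (Metric.closedBall_mem_nhds x one_pos) ?_ ?_ ?_ ?_ ?_ ?_
  · refine Filter.Eventually.of_forall fun y => ?_
    exact (hf.continuous.comp (by fun_prop : Continuous fun t : ℝ => (y, t))).aestronglyMeasurable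
  · exact (hf.continuous.comp (by fun_prop : Continuous fun t : ℝ => (x, t))).intervalIntegrable _ _
  · exact (hc.comp (by fun_prop : Continuous fun t : ℝ => (x, t))).aestronglyMeasurable
  · refine Filter.Eventually.of_forall fun t ht y hy => ?_
    rw [Set.uIoc_of_le zero_le_one] at ht
    exact hC ⟨(y, t), ⟨hy, Set.Ioc_subset_Icc_self ht⟩, rfl⟩
  · exact intervalIntegrable_const
  · refine Filter.Eventually.of_forall fun t _ y _ => ?_
    have h1 : HasFDerivAt f (fderiv ℝ f (y, t)) (y, t) :=
      (hf.differentiable (by simp) (y, t)).hasFDerivAt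
    exact h1.comp y (hasFDerivAt_prodMk_left y t)

/-- The derivative is again an integral of the same kind, with values in E →L[ℝ] G; the target G
therefore varies in the induction. -/
theorem contDiff_nat_integral {E : Type u} [NormedAddCommGroup E] [NormedSpace ℝ E]
    [FiniteDimensional ℝ E] (k : ℕ) : ∀ {G : Type u} [NormedAddCommGroup G] [NormedSpace ℝ G]
    [CompleteSpace G] {f : E × ℝ → G}, ContDiff ℝ ∞ f →
      ContDiff ℝ k fun x => ∫ t in (0 : ℝ)..1, f (x, t) := by
  induction k with
  | zero =>
    intro G _ _ _ f hf
    refine contDiff_zero.2 (continuous_iff_continuousAt.2 fun x => ?_)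
    exact (hasFDerivAt_integral_of_contDiff hf x).continuousAt
  | succ k ih =>
    intro G _ _ _ f hf
    refine contDiff_succ_iff_hasFDerivAt.2 ⟨_, ih (f := fun q : E × ℝ =>
      (fderiv ℝ f q).comp (ContinuousLinearMap.inl ℝ E ℝ)) ?_, hasFDerivAt_integral_of_contDiff hf⟩
    exact (hf.fderiv_right (by simp)).clm_comp contDiff_const

theorem contDiff_integral {E G : Type u} [NormedAddCommGroup E] [NormedSpace ℝ E]
    [FiniteDimensional ℝ E] [NormedAddCommGroup G] [NormedSpace ℝ G] [CompleteSpace G]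
    {f : E × ℝ → G} (hf : ContDiff ℝ ∞ f) :
    ContDiff ℝ ∞ fun x => ∫ t in (0 : ℝ)..1, f (x, t) :=
  contDiff_infty.2 fun k => contDiff_nat_integral k hf

/-- Hadamard's lemma: integrate the derivative of F along the segment from p to x, so that G_i(x) is
the mean of ∂_i F over that segment. -/
theorem exists_eq_sum_mul_of_apply_eq_zero {n : ℕ} {F : Euc n → ℝ} (hF : ContDiff ℝ ∞ F)
    (p : Euc n) (hp : F p = 0) :
    ∃ G : Fin n → Euc n → ℝ, (∀ i, ContDiff ℝ ∞ (G i)) ∧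
      (∀ x, F x = ∑ i, (x i - p i) * G i x) ∧
      ∀ i, G i p = fderiv ℝ F p (EuclideanSpace.single i 1) := by
  have hdF : ContDiff ℝ ∞ (fderiv ℝ F) := hF.fderiv_right (by simp)
  refine ⟨fun i x => ∫ t in (0 : ℝ)..1, fderiv ℝ F (p + t • (x - p)) (EuclideanSpace.single i 1),
    fun i => ?_, fun x => ?_, fun i => by simp⟩
  · refine contDiff_integral (f := fun q : Euc n × ℝ =>
      fderiv ℝ F (p + q.2 • (q.1 - p)) (EuclideanSpace.single i 1)) ?_
    exact (hdF.comp (by fun_prop)).clm_apply contDiff_const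
  · have hline : ∀ t : ℝ, HasDerivAt (fun t : ℝ => F (p + t • (x - p)))
        (fderiv ℝ F (p + t • (x - p)) (x - p)) t := fun t => by
      have h1 := ((hF.differentiable (by simp)) (p + t • (x - p))).hasFDerivAt
      have h2 : HasDerivAt (fun t : ℝ => p + t • (x - p)) (x - p) t := by
        simpa using ((hasDerivAt_id t).smul_const (x - p)).const_add p
      exact h1.comp_hasDerivAt t h2
    have hcont : ∀ v : Euc n, Continuous fun t : ℝ => fderiv ℝ F (p + t • (x - p)) v := fun v =>
      (hdF.continuous.comp (by fun_prop)).clm_apply continuous_const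
    have key := integral_eq_sub_of_hasDerivAt (a := 0) (b := 1) (fun t _ => hline t)
      ((hcont _).intervalIntegrable _ _)
    have hx : F x = ∫ t in (0 : ℝ)..1, fderiv ℝ F (p + t • (x - p)) (x - p) := by
      rw [key]; simp [hp]
    have hsum : x - p = ∑ i, (x i - p i) • EuclideanSpace.single i (1 : ℝ) := by
      ext j; simp [Finset.sum_apply, Pi.single_apply]
    rw [hx]
    simp_rw [← intervalIntegral.integral_const_mul]
    rw [← intervalIntegral.integral_finsetSum
      (fun i _ => ((hcont _).intervalIntegrable _ _).const_mul _)]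
    refine intervalIntegral.integral_congr fun t _ => ?_
    conv_lhs => rw [hsum]
    rw [map_sum]
    simp only [map_smul, smul_eq_mul]
    rw [← hsum]

end Hadamard

/-! ### Smooth functions on open subsets of `ℝⁿ` -/

namespace Smooth

variable {n : ℕ} {V W : Opens (Euc n)}

/-- The extension of a smooth function by zero. -/
noncomputable abbrev ext0 (f : Smooth V) : Euc n → ℝ := Function.extend Subtype.val f 0

theorem ext0_apply (f : Smooth V) (x : V) : f.ext0 x = f x :=
  Subtype.val_injective.extend_apply _ _ _

theorem contDiffOn_ext0 (f : Smooth V) : ContDiffOn ℝ ∞ f.ext0 V :=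
  (contMDiff_iff_extend _).1 f.contMDiff

theorem contDiffAt_ext0 (f : Smooth V) (x : V) : ContDiffAt ℝ ∞ f.ext0 x :=
  f.contDiffOn_ext0.contDiffAt (V.isOpen.mem_nhds x.2)

theorem differentiableAt_ext0 (f : Smooth V) (x : V) : DifferentiableAt ℝ f.ext0 x :=
  (f.contDiffAt_ext0 x).differentiableAt (by simp)

/-- Evaluation at a point. -/
noncomputable def eval (p : V) : Smooth V →ₐ[ℝ] ℝ where
  toFun f := f p
  map_one' := rfl
  map_mul' _ _ := rfl
  map_zero' := rfl
  map_add' _ _ := rfl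
  commutes' _ := rfl

theorem eval_apply (p : V) (f : Smooth V) : eval p f = f p := rfl

theorem sum_apply {ι : Type*} (s : Finset ι) (f : ι → Smooth V) (x : V) :
    (∑ i ∈ s, f i) x = ∑ i ∈ s, f i x :=
  map_sum (eval x) f s

theorem partialDeriv_apply (μ : Fin n) (f : Smooth V) (x : V) :
    partialDeriv V μ f x = fderiv ℝ f.ext0 x (EuclideanSpace.single μ 1) := rfl

theorem partialDeriv_apply_of_eqOn (μ : Fin n) (f : Smooth V) {F : Euc n → ℝ} (x : V)
    {s : Set (Euc n)} (hs : s ∈ nhds (x : Euc n)) (h : ∀ y : V, (y : Euc n) ∈ s → f y = F y) :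
    partialDeriv V μ f x = fderiv ℝ F x (EuclideanSpace.single μ 1) := by
  rw [partialDeriv_apply]
  congr 1
  refine Filter.EventuallyEq.fderiv_eq ?_
  filter_upwards [V.isOpen.mem_nhds x.2, hs] with y hy hys
  exact (ext0_apply f ⟨y, hy⟩).trans (h ⟨y, hy⟩ hys)

theorem partialDeriv_apply_of_eq (μ : Fin n) (f : Smooth V) {F : Euc n → ℝ} (x : V)
    (h : ∀ y : V, f y = F y) :
    partialDeriv V μ f x = fderiv ℝ F x (EuclideanSpace.single μ 1) :=
  partialDeriv_apply_of_eqOn μ f x Filter.univ_mem fun y _ => h y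

theorem partialDeriv_mul (μ : Fin n) (f g : Smooth V) :
    partialDeriv V μ (f * g) = partialDeriv V μ f * g + f * partialDeriv V μ g := by
  ext x
  rw [partialDeriv_apply_of_eq (F := f.ext0 * g.ext0) μ (f * g) x
    (fun y => by rw [Pi.mul_apply, ext0_apply, ext0_apply]; rfl),
    fderiv_mul (f.differentiableAt_ext0 x) (g.differentiableAt_ext0 x)]
  simp [partialDeriv_apply]
  ring

theorem partialDeriv_one (μ : Fin n) : partialDeriv V μ 1 = 0 := by
  have h := partialDeriv_mul μ (1 : Smooth V) 1
  simpa using h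

theorem partialDeriv_coord (μ ν : Fin n) :
    partialDeriv V μ (coord V ν) = if μ = ν then 1 else 0 := by
  ext x
  rw [partialDeriv_apply_of_eq (F := EuclideanSpace.proj (𝕜 := ℝ) ν) μ _ x (fun y => rfl),
    ContinuousLinearMap.fderiv]
  change (EuclideanSpace.single μ (1 : ℝ)) ν = _
  rcases eq_or_ne μ ν with rfl | h
  · simp
  · simp [h, h.symm]

theorem partialDeriv_res (h : W ≤ V) (μ : Fin n) (f : Smooth V) :
    partialDeriv W μ (res h f) = res h (partialDeriv V μ f) := by
  ext x
  exact partialDeriv_apply_of_eq μ _ x fun y => (ext0_apply f ⟨y, h y.2⟩).symm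

theorem partialDeriv_comm (μ ν : Fin n) (f : Smooth V) :
    partialDeriv V μ (partialDeriv V ν f) = partialDeriv V ν (partialDeriv V μ f) := by
  ext x
  have hd : DifferentiableAt ℝ (fderiv ℝ f.ext0) x :=
    ((f.contDiffAt_ext0 x).fderiv_right (m := ∞) (by simp)).differentiableAt (by simp)
  have key (μ ν : Fin n) : partialDeriv V μ (partialDeriv V ν f) x =
      fderiv ℝ (fderiv ℝ f.ext0) x (EuclideanSpace.single μ 1) (EuclideanSpace.single ν 1) := by
    rw [partialDeriv_apply_of_eq (F := fun y => fderiv ℝ f.ext0 y (EuclideanSpace.single ν 1)) μ _ x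
      (fun y => rfl), fderiv_clm_apply hd (differentiableAt_const _)]
    simp
  rw [key, key]
  exact ((f.contDiffAt_ext0 x).isSymmSndFDerivAt (by simpa using (ENat.LEInfty.out : (2 : WithTop ℕ∞) ≤ ∞))).eq _ _

/-- The restriction to an open set of a smooth function on `ℝⁿ`. -/
noncomputable def ofContDiff (V : Opens (Euc n)) (F : Euc n → ℝ) (hF : ContDiff ℝ ∞ F) : Smooth V :=
  ⟨fun x => F x, (contMDiff_iff_contDiff.2 hF).comp contMDiff_subtype_val⟩

/-- A point derivation of `C^∞(V)` is a linear combination of the partial derivatives. -/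
theorem pointDerivation_eq_sum (p : V) (δ : Smooth V →ₗ[ℝ] ℝ)
    (hδ : ∀ f g, δ (f * g) = f p * δ g + g p * δ f) (f : Smooth V) :
    δ f = ∑ μ, partialDeriv V μ f p * δ (coord V μ) := by
  have h1 : δ 1 = 0 := by
    have h := hδ 1 1
    simpa using h
  -- It suffices to treat functions vanishing to first order at p: the general case follows by
  -- subtracting the first-order Taylor polynomial.
  have hvan : ∀ f : Smooth V, f p = 0 → (∀ μ, partialDeriv V μ f p = 0) → δ f = 0 := by
    intro f hfp hdf
    obtain ⟨r, hr, hrV⟩ := Metric.isOpen_iff.1 V.isOpen p p.2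
    -- V need not be convex, so f is cut off to a smooth function χf on all of ℝⁿ before Hadamard's
    -- lemma is applied; the support of χ is the closed ball of radius r/2 < r, inside V.
    let χ : ContDiffBump (p : Euc n) := ⟨r / 4, r / 2, by positivity, by linarith⟩
    have hF : ContDiff ℝ ∞ fun x => χ x * f.ext0 x := by
      rw [contDiff_iff_contDiffAt]
      intro x
      by_cases hx : x ∈ V
      · exact χ.contDiff.contDiffAt.mul (f.contDiffAt_ext0 ⟨x, hx⟩)
      · refine (contDiffAt_const (c := (0 : ℝ))).congr_of_eventuallyEq ?_
        have hx' : x ∉ tsupport χ := fun hxs => hx (hrV (by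
          rw [χ.tsupport_eq] at hxs
          exact Metric.closedBall_subset_ball (by simp [χ]; linarith) hxs))
        filter_upwards [(isClosed_tsupport χ).isOpen_compl.mem_nhds hx'] with y hy
        rw [image_eq_zero_of_notMem_tsupport hy, zero_mul]
    obtain ⟨G, hG, hFG, hGp⟩ := exists_eq_sum_mul_of_apply_eq_zero hF p
      (by rw [ext0_apply, hfp, mul_zero])
    have hGp0 : ∀ i, G i p = 0 := fun i => by
      rw [hGp, ← hdf i, partialDeriv_apply]
      congr 1
      refine Filter.EventuallyEq.fderiv_eq ?_
      filter_upwards [χ.eventuallyEq_one] with y hy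
      rw [hy, Pi.one_apply, one_mul]
    -- Each summand is a product of two functions vanishing at p, so δ kills it: G_i(p) = ∂_i f(p) =
    -- 0, and 1 - χ vanishes at p.
    have hdecomp : f = ∑ i, (coord V i - algebraMap ℝ _ ((p : Euc n) i)) * ofContDiff V (G i) (hG i)
        + (1 - ofContDiff V χ χ.contDiff) * f := by
      ext x
      have h2 := hFG x
      rw [ext0_apply] at h2
      have h3 : (∑ i, (coord V i - algebraMap ℝ _ ((p : Euc n) i)) * ofContDiff V (G i) (hG i) :
          Smooth V) x = ∑ i, ((x : Euc n) i - (p : Euc n) i) * G i x := by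
        rw [sum_apply]
        rfl
      change f x = (∑ i, (coord V i - algebraMap ℝ _ ((p : Euc n) i)) * ofContDiff V (G i) (hG i) :
          Smooth V) x + (1 - χ x) * f x
      rw [h3, ← h2]
      ring
    rw [hdecomp, map_add, map_sum, hδ, hfp]
    have h4 : (1 - ofContDiff V χ χ.contDiff : Smooth V) p = 0 := by
      change 1 - χ p = 0
      rw [χ.one_of_mem_closedBall (Metric.mem_closedBall_self χ.rIn_pos.le), sub_self]
    rw [h4, zero_mul, zero_mul, add_zero, add_zero]
    refine Finset.sum_eq_zero fun i _ => ?_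
    rw [hδ]
    have h5 : ofContDiff V (G i) (hG i) p = 0 := hGp0 i
    have h6 : (coord V i - algebraMap ℝ (Smooth V) ((p : Euc n) i)) p = 0 := by
      change (p : Euc n) i - (p : Euc n) i = 0
      ring
    rw [h5, h6]
    ring
  have h2 := hvan (f - f p • (1 : Smooth V) -
    ∑ μ, partialDeriv V μ f p • (coord V μ - ((p : Euc n) μ) • (1 : Smooth V))) ?_ ?_
  · simpa [h1, sub_eq_zero] using h2
  · simp only [← eval_apply, map_sub, map_sum, map_smul, map_one, smul_eq_mul, mul_one,
      sub_self, zero_sub, neg_eq_zero]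
    refine Finset.sum_eq_zero fun i _ => mul_eq_zero_of_right _ (sub_self _)
  · intro ν
    simp [partialDeriv_one, partialDeriv_coord, ← eval_apply]

/-- The composition of a smooth function with a function that is smooth along its values. -/
noncomputable def comp (F : ℝ → ℝ) (f : Smooth V) (hF : ∀ x, ContDiffAt ℝ ∞ F (f x)) : Smooth V :=
  ⟨fun x => F (f x), fun x => (contMDiffAt_iff_contDiffAt.2 (hF x)).comp x (f.contMDiff x)⟩

theorem partialDeriv_comp (F : ℝ → ℝ) (f : Smooth V) (hF : ∀ x, ContDiffAt ℝ ∞ F (f x)) (μ : Fin n)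
    (x : V) : partialDeriv V μ (comp F f hF) x = deriv F (f x) * partialDeriv V μ f x := by
  rw [partialDeriv_apply_of_eq (F := F ∘ f.ext0) μ _ x
    (fun y => by rw [Function.comp_apply, ext0_apply]; rfl)]
  have h1 : DifferentiableAt ℝ F (f.ext0 x) := by
    rw [ext0_apply]; exact (hF x).differentiableAt (by simp)
  rw [fderiv_comp _ h1 (f.differentiableAt_ext0 x)]
  simp only [ContinuousLinearMap.comp_apply, partialDeriv_apply, ext0_apply]
  rw [← toSpanSingleton_deriv]
  simp [mul_comm]

theorem isUnit_of_forall_ne_zero (f : Smooth V) (hf : ∀ x, f x ≠ 0) : IsUnit f := by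
  refine IsUnit.of_mul_eq_one (comp (fun t => t⁻¹) f fun x => contDiffAt_inv ℝ (hf x)) ?_
  ext x
  exact mul_inv_cancel₀ (hf x)

end Smooth

theorem zmod_two_cases (i : ZMod 2) : i = 0 ∨ i = 1 := by
  revert i; decide

/-! ### The Grassmann algebra -/

namespace Grassmann

variable {m : ℕ}

/-- The generator `v` of the Grassmann algebra. -/
noncomputable abbrev ι (v : Fin m → ℝ) : Grassmann m := ExteriorAlgebra.ι ℝ v

/-- The contraction with a linear form. -/
noncomputable abbrev contract (d : Module.Dual ℝ (Fin m → ℝ)) : Grassmann m →ₗ[ℝ] Grassmann m :=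
  CliffordAlgebra.contractLeft (Q := (0 : QuadraticForm ℝ (Fin m → ℝ))) d

/-- The decomposition of the Grassmann algebra into its even and odd part. -/
noncomputable abbrev grading (i : ZMod 2) : Submodule ℝ (Grassmann m) :=
  CliffordAlgebra.evenOdd (0 : QuadraticForm ℝ (Fin m → ℝ)) i

@[elab_as_elim]
theorem left_induction {P : Grassmann m → Prop} (one : ∀ r, P (algebraMap ℝ _ r))
    (add : ∀ x y, P x → P y → P (x + y)) (ι_mul : ∀ x v, P x → P (ι v * x)) (x : Grassmann m) :
    P x :=
  CliffordAlgebra.left_induction (Q := (0 : QuadraticForm ℝ (Fin m → ℝ))) one add ι_mul x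

theorem ι_mem (v : Fin m → ℝ) : ι v ∈ grading (m := m) 1 := CliffordAlgebra.ι_mem_evenOdd_one _ v

theorem contract_ι_mul (d : Module.Dual ℝ (Fin m → ℝ)) (v : Fin m → ℝ) (x : Grassmann m) :
    contract d (ι v * x) = d v • x - ι v * contract d x :=
  CliffordAlgebra.contractLeft_ι_mul _ _ _

theorem contract_ι (d : Module.Dual ℝ (Fin m → ℝ)) (v : Fin m → ℝ) :
    contract d (ι v) = algebraMap ℝ _ (d v) := CliffordAlgebra.contractLeft_ι _ _ _

theorem contract_algebraMap (d : Module.Dual ℝ (Fin m → ℝ)) (r : ℝ) :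
    contract d (algebraMap ℝ _ r) = 0 := CliffordAlgebra.contractLeft_algebraMap _ _ _

theorem contract_one (d : Module.Dual ℝ (Fin m → ℝ)) : contract d 1 = 0 :=
  CliffordAlgebra.contractLeft_one _ _

/-- The parity involution. -/
noncomputable abbrev invol : Grassmann m →ₐ[ℝ] Grassmann m :=
  CliffordAlgebra.involute (Q := (0 : QuadraticForm ℝ (Fin m → ℝ)))

theorem invol_ι (v : Fin m → ℝ) : invol (ι v) = -ι v := CliffordAlgebra.involute_ι _

theorem invol_of_mem {i : ZMod 2} {x : Grassmann m} (hx : x ∈ grading i) :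
    invol x = ((-1 : ℤˣ) ^ i) • x := by
  rcases zmod_two_cases i with rfl | rfl
  · simpa using CliffordAlgebra.involute_eq_of_mem_even hx
  · simpa [Units.smul_def] using CliffordAlgebra.involute_eq_of_mem_odd hx

/-- Contraction is an odd derivation: moving it past x costs the parity involution. -/
theorem contract_mul' (d : Module.Dual ℝ (Fin m → ℝ)) (x y : Grassmann m) :
    contract d (x * y) = contract d x * y + invol x * contract d y := by
  induction x using left_induction with
  | one r => simp [← Algebra.smul_def]
  | add x x' hx hx' => simp only [add_mul, map_add, hx, hx']; abel
  | ι_mul x v hx =>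
    rw [mul_assoc, contract_ι_mul, hx, contract_ι_mul, map_mul, invol_ι]
    simp only [sub_mul, mul_add, smul_mul_assoc, mul_assoc, neg_mul]
    abel

theorem ι_anticomm (v w : Fin m → ℝ) : ι v * ι w = -(ι w * ι v) :=
  eq_neg_of_add_eq_zero_left (by
    simp)

theorem ι_mul' (v : Fin m → ℝ) (x : Grassmann m) : ι v * x = invol x * ι v := by
  induction x using left_induction with
  | one r => simp [Algebra.commutes]
  | add x x' hx hx' => simp only [add_mul, map_add, mul_add, hx, hx']
  | ι_mul x w hx =>
    rw [← mul_assoc, ι_anticomm, map_mul, invol_ι, neg_mul, mul_assoc, hx]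
    simp only [neg_mul, mul_assoc]

theorem mul_comm' {i j : ZMod 2} {x y : Grassmann m} (hx : x ∈ grading i) (hy : y ∈ grading j) :
    x * y = ((-1 : ℤˣ) ^ (i * j)) • (y * x) := by
  -- Fixing a homogeneous y and inducting on an arbitrary x avoids tracking the parity of x; an odd
  -- y passes x at the cost of the involution.
  have key : ∀ y : Grassmann m, y ∈ grading j → ∀ x : Grassmann m,
      x * y = y * (if j = 0 then x else invol x) := by
    intro y hy x
    induction x using left_induction with
    | one r => simp [Algebra.commutes]
    | add x x' hx hx' =>
      rw [add_mul, hx, hx']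
      split_ifs <;> simp [mul_add]
    | ι_mul x v hx =>
      rw [mul_assoc, hx, ← mul_assoc, ι_mul', invol_of_mem hy, mul_assoc]
      rcases zmod_two_cases j with rfl | rfl
      · simp
      · simp [Units.smul_def]
  rw [key y hy x]
  rcases zmod_two_cases j with rfl | rfl
  · simp
  · rw [if_neg one_ne_zero, invol_of_mem hx, mul_one]
    exact mul_smul_comm _ _ _

theorem contract_mem (d : Module.Dual ℝ (Fin m → ℝ)) {i : ZMod 2} {x : Grassmann m}
    (hx : x ∈ grading i) : contract d x ∈ grading (m := m) (i + 1) := by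
  induction x, hx using CliffordAlgebra.evenOdd_induction with
  | range_ι_pow v h =>
    rcases zmod_two_cases i with rfl | rfl
    · rw [ZMod.val_zero, pow_zero] at h
      obtain ⟨r, rfl⟩ := Submodule.mem_one.1 h
      rw [contract_algebraMap]
      exact Submodule.zero_mem _
    · rw [ZMod.val_one, pow_one] at h
      obtain ⟨w, rfl⟩ := h
      change contract d (ι w) ∈ _
      rw [contract_ι]
      exact SetLike.algebraMap_mem_graded
        (CliffordAlgebra.evenOdd (0 : QuadraticForm ℝ (Fin m → ℝ))) _
  | add x y hx hy ihx ihy => rw [map_add]; exact Submodule.add_mem _ ihx ihy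
  | ι_mul_ι_mul v w x hx ih =>
    change contract d (ι v * ι w * x) ∈ _
    rw [mul_assoc, contract_ι_mul, contract_ι_mul]
    have h1 : ι w * x ∈ grading (m := m) (i + 1) := by
      rw [add_comm]; exact SetLike.mul_mem_graded (ι_mem w) hx
    have h2 : d w • x - ι w * contract d x ∈ grading (m := m) i := by
      refine Submodule.sub_mem _ (Submodule.smul_mem _ _ hx) ?_
      have := SetLike.mul_mem_graded (ι_mem w) ih
      rwa [add_comm i, ← add_assoc, (by decide : (1 + 1 : ZMod 2) = 0), zero_add] at this
    refine Submodule.sub_mem _ (Submodule.smul_mem _ _ h1) ?_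
    rw [add_comm]; exact SetLike.mul_mem_graded (ι_mem v) h2

theorem ι_eq_sum (v : Fin m → ℝ) : ι v = ∑ i, v i • ι (Pi.single i (1 : ℝ)) := by
  have h : v = ∑ i, v i • Pi.single i (1 : ℝ) := by
    ext j; simp [Finset.sum_apply, Pi.single_apply]
  conv_lhs => rw [h]
  simp only [ι, map_sum, map_smul]

/-- The Euler operator `∑ ξ^i ∂/∂ξ^i`. -/
noncomputable def euler : Grassmann m →ₗ[ℝ] Grassmann m :=
  ∑ i, LinearMap.mulLeft ℝ (ι (Pi.single i (1 : ℝ))) ∘ₗ contract (LinearMap.proj i)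

theorem euler_apply (x : Grassmann m) :
    euler x = ∑ i, ι (Pi.single i (1 : ℝ)) * contract (LinearMap.proj i) x := by
  simp [euler]

theorem euler_ι_mul (v : Fin m → ℝ) (x : Grassmann m) :
    euler (ι v * x) = ι v * x + ι v * euler x := by
  have h (i : Fin m) : ι (Pi.single i (1 : ℝ)) * contract (LinearMap.proj i) (ι v * x) =
      v i • ι (Pi.single i (1 : ℝ)) * x +
        ι v * (ι (Pi.single i (1 : ℝ)) * contract (LinearMap.proj i) x) := by
    rw [contract_ι_mul, mul_sub, ← mul_assoc, ι_anticomm, neg_mul, sub_neg_eq_add, mul_assoc,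
      mul_smul_comm, smul_mul_assoc]
    rfl
  rw [euler_apply, euler_apply, Finset.sum_congr rfl fun i _ => h i, Finset.sum_add_distrib,
    ← Finset.sum_mul, ← ι_eq_sum, Finset.mul_sum]

theorem euler_of_mem {k : ℕ} {x : Grassmann m} (hx : x ∈ ⋀[ℝ]^k (Fin m → ℝ)) :
    euler x = (k : ℝ) • x := by
  induction hx using Submodule.pow_induction_on_left' with
  | algebraMap r => simp [euler_apply]
  | add x y i hx hy ihx ihy => rw [map_add, ihx, ihy, smul_add]
  | mem_mul v hv i x hx ih =>
    obtain ⟨v, rfl⟩ := hv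
    rw [euler_ι_mul, ih, mul_smul_comm]
    push_cast
    rw [add_smul, one_smul, add_comm]

theorem decompose_euler (x : Grassmann m) (k : ℕ) :
    (DirectSum.decompose (fun i : ℕ => ⋀[ℝ]^i (Fin m → ℝ)) (euler x) k : Grassmann m) =
      (k : ℝ) • (DirectSum.decompose (fun i : ℕ => ⋀[ℝ]^i (Fin m → ℝ)) x k : Grassmann m) := by
  induction x using DirectSum.Decomposition.inductionOn fun i : ℕ => ⋀[ℝ]^i (Fin m → ℝ) with
  | zero => simp
  | add x y hx hy => simp [DirectSum.decompose_add, hx, hy]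
  | @homogeneous j x =>
    rw [euler_of_mem x.2]
    rcases eq_or_ne j k with rfl | h
    · rw [DirectSum.decompose_of_mem_same (fun i : ℕ => ⋀[ℝ]^i (Fin m → ℝ)) (Submodule.smul_mem _ _ x.2),
        DirectSum.decompose_of_mem_same (fun i : ℕ => ⋀[ℝ]^i (Fin m → ℝ)) x.2]
    · rw [DirectSum.decompose_of_mem_ne (fun i : ℕ => ⋀[ℝ]^i (Fin m → ℝ)) (Submodule.smul_mem _ _ x.2) h,
        DirectSum.decompose_of_mem_ne (fun i : ℕ => ⋀[ℝ]^i (Fin m → ℝ)) x.2 h, smul_zero]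

/-- The projection of the Grassmann algebra onto the scalars. -/
noncomputable abbrev aug : Grassmann m →ₐ[ℝ] ℝ := ExteriorAlgebra.algebraMapInv

theorem aug_ι (v : Fin m → ℝ) : aug (ι v) = 0 := by
  simp [ExteriorAlgebra.algebraMapInv]

open Classical in
-- The Euler operator multiplies degree k by k, so its kernel consists of the scalars.
theorem eq_algebraMap_of_contract_eq_zero {x : Grassmann m}
    (hx : ∀ i, contract (LinearMap.proj i) x = 0) : x = algebraMap ℝ _ (aug x) := by
  have h0 : euler x = 0 := by simp [euler_apply, hx]
  have h1 : ∀ k : ℕ, k ≠ 0 →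
      (DirectSum.decompose (fun i : ℕ => ⋀[ℝ]^i (Fin m → ℝ)) x k : Grassmann m) = 0 := by
    intro k hk
    have h := decompose_euler x k
    rw [h0, DirectSum.decompose_zero] at h
    simpa [hk] using h.symm
  have h2 : x = (DirectSum.decompose (fun i : ℕ => ⋀[ℝ]^i (Fin m → ℝ)) x 0 : Grassmann m) := by
    conv_lhs => rw [← DirectSum.sum_support_decompose (fun i : ℕ => ⋀[ℝ]^i (Fin m → ℝ)) x]
    refine Finset.sum_eq_single 0 (fun k _ hk => h1 k hk) fun h => ?_
    simpa using h
  have h3 := (DirectSum.decompose (fun i : ℕ => ⋀[ℝ]^i (Fin m → ℝ)) x 0).2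
  rw [← h2] at h3
  obtain ⟨r, rfl⟩ := Submodule.mem_one.1 ((pow_zero (LinearMap.range _)).le h3)
  simp

theorem mem_range_mul_top {x : Grassmann m} (hx : aug x = 0) :
    x ∈ LinearMap.range (ExteriorAlgebra.ι ℝ (M := Fin m → ℝ)) * (⊤ : Submodule ℝ (Grassmann m)) := by
  have h : x - algebraMap ℝ _ (aug x) ∈
      LinearMap.range (ExteriorAlgebra.ι ℝ (M := Fin m → ℝ)) * (⊤ : Submodule ℝ (Grassmann m)) := by
    clear hx
    induction x using left_induction with
    | one r => simp
    | add x y hx hy =>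
      have := Submodule.add_mem _ hx hy
      rwa [sub_add_sub_comm, ← map_add, ← map_add] at this
    | ι_mul x v _ =>
      rw [map_mul, aug_ι, zero_mul, map_zero, sub_zero]
      exact Submodule.mul_mem_mul ⟨v, rfl⟩ trivial
  simpa [hx] using h

/-- The augmentation ideal is R·Λ with R the span of the generators. As Λ·R ⊆ R·Λ, the k-th power of
x lies in R^k·Λ, and R^(m+1) is the exterior power of degree m + 1 of an m-dimensional space. -/
theorem pow_eq_zero_of_aug_eq_zero {x : Grassmann m} (hx : aug x = 0) : x ^ (m + 1) = 0 := by
  set R := LinearMap.range (ExteriorAlgebra.ι ℝ (M := Fin m → ℝ))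
  have h1 : (⊤ : Submodule ℝ (Grassmann m)) * R ≤ R * ⊤ := by
    refine Submodule.mul_le.2 fun y _ z hz => ?_
    refine mem_range_mul_top ?_
    obtain ⟨v, rfl⟩ := hz
    rw [map_mul, aug_ι, mul_zero]
  have h2 : ∀ k, x ^ k ∈ R ^ k * (⊤ : Submodule ℝ (Grassmann m)) := by
    intro k
    induction k with
    | zero => simp
    | succ k ih =>
      have h3 := Submodule.mul_mem_mul ih (mem_range_mul_top hx)
      rw [← pow_succ] at h3
      refine (?_ : R ^ k * ⊤ * (R * ⊤) ≤ R ^ (k + 1) * (⊤ : Submodule ℝ (Grassmann m))) h3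
      calc R ^ k * ⊤ * (R * ⊤) = R ^ k * (⊤ * R) * ⊤ := by simp only [mul_assoc]
        _ ≤ R ^ k * (R * ⊤) * ⊤ := by gcongr
        _ = R ^ (k + 1) * (⊤ * ⊤) := by simp only [pow_succ, mul_assoc]
        _ ≤ R ^ (k + 1) * ⊤ := by gcongr; exact le_top
  have h4 : R ^ (m + 1) = ⊥ := by
    refine Submodule.finrank_eq_zero.1 ?_
    have := exteriorPower.finrank_eq ℝ (M := Fin m → ℝ) (m + 1)
    simpa using this
  have h5 := h2 (m + 1)
  rw [h4, Submodule.bot_mul] at h5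
  exact h5

end Grassmann

/-! ### Superderivations -/

/-- A derivation of parity `p` of a `ℤ/2`-graded algebra. -/
structure IsSuperDerivation {R : Type*} [Ring R] [Algebra ℝ R] (𝒜 : ZMod 2 → Submodule ℝ R)
    (p : ZMod 2) (D : R →ₗ[ℝ] R) : Prop where
  mem : ∀ {i : ZMod 2} {f : R}, f ∈ 𝒜 i → D f ∈ 𝒜 (i + p)
  leibniz : ∀ {i : ZMod 2} {f : R} (g : R), f ∈ 𝒜 i →
    D (f * g) = D f * g + ((-1 : ℤˣ) ^ (p * i)) • (f * D g)

namespace IsSuperDerivation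

variable {R : Type*} [Ring R] [Algebra ℝ R] {𝒜 : ZMod 2 → Submodule ℝ R} {p : ZMod 2}
  {D : R →ₗ[ℝ] R} (hD : IsSuperDerivation 𝒜 p D)

include hD

theorem leibniz_zero {f : R} (g : R) (hf : f ∈ 𝒜 0) : D (f * g) = D f * g + f * D g := by
  simpa using hD.leibniz g hf

theorem map_one (h1 : (1 : R) ∈ 𝒜 0) : D 1 = 0 := by
  simpa using hD.leibniz_zero 1 h1

end IsSuperDerivation

theorem IsSuperDerivation.pow_succ' {R : Type*} [Ring R] [Algebra ℝ R]
    {𝒜 : ZMod 2 → Submodule ℝ R} [SetLike.GradedMonoid 𝒜] {p : ZMod 2} {D : R →ₗ[ℝ] R}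
    (hD : IsSuperDerivation 𝒜 p D) {w : R} (hw : w ∈ 𝒜 0) (hc : Commute w (D w)) (k : ℕ) :
    D (w ^ (k + 1)) = ((k : ℝ) + 1) • (D w * w ^ k) := by
  induction k with
  | zero => simp
  | succ k ih =>
    rw [_root_.pow_succ', hD.leibniz_zero _ hw, ih, mul_smul_comm, ← mul_assoc, hc.eq, mul_assoc,
      ← _root_.pow_succ']
    push_cast
    module

/-! ### Superfunctions on superdomains -/

namespace Model

variable {n m : ℕ} {V W : Opens (Euc n)}

theorem tmul_mem (s : Smooth V) {i : ZMod 2} {x : Grassmann m} (hx : x ∈ Grassmann.grading i) :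
    s ⊗ₜ[ℝ] x ∈ grading V i :=
  ⟨s ⊗ₜ[ℝ] ⟨x, hx⟩, rfl⟩

@[elab_as_elim]
theorem grading_induction {i : ZMod 2} {P : ∀ f : Model m V, f ∈ grading V i → Prop}
    (tmul : ∀ (s : Smooth V) (x : Grassmann m) (hx : x ∈ Grassmann.grading i),
      P (s ⊗ₜ x) (tmul_mem s hx))
    (add : ∀ f g hf hg, P f hf → P g hg → P (f + g) (Submodule.add_mem _ hf hg))
    (f : Model m V) (hf : f ∈ grading V i) : P f hf := by
  obtain ⟨t, rfl⟩ := hf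
  induction t using TensorProduct.induction_on with
  | zero => simpa using tmul 0 0 (Submodule.zero_mem _)
  | tmul s x => exact tmul s x x.2
  | add f g hf hg => simpa only [map_add] using add _ _ ⟨f, rfl⟩ ⟨g, rfl⟩ hf hg

theorem one_mem_grassmann : (1 : Grassmann m) ∈ Grassmann.grading (m := m) 0 :=
  SetLike.one_mem_graded (CliffordAlgebra.evenOdd (0 : QuadraticForm ℝ (Fin m → ℝ)))

theorem tmul_one_mem (s : Smooth V) : s ⊗ₜ[ℝ] (1 : Grassmann m) ∈ grading V 0 :=
  tmul_mem s one_mem_grassmann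

theorem mul_mem {i j : ZMod 2} {f g : Model m V} (hf : f ∈ grading V i) (hg : g ∈ grading V j) :
    f * g ∈ grading V (i + j) := by
  induction f, hf using grading_induction with
  | tmul s x hx =>
    induction g, hg using grading_induction with
    | tmul t y hy =>
      rw [Algebra.TensorProduct.tmul_mul_tmul]
      exact tmul_mem _ (SetLike.mul_mem_graded hx hy)
    | add f g _ _ hf hg => rw [mul_add]; exact Submodule.add_mem _ hf hg
  | add f g _ _ hf hg => rw [add_mul]; exact Submodule.add_mem _ hf hg

instance : SetLike.GradedMonoid (grading (m := m) V) where
  one_mem := tmul_one_mem 1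
  mul_mem _ _ _ _ hf hg := mul_mem hf hg

theorem mul_comm' {i j : ZMod 2} {f g : Model m V} (hf : f ∈ grading V i) (hg : g ∈ grading V j) :
    f * g = ((-1 : ℤˣ) ^ (i * j)) • (g * f) := by
  induction f, hf using grading_induction with
  | tmul s x hx =>
    induction g, hg using grading_induction with
    | tmul t y hy =>
      rw [Algebra.TensorProduct.tmul_mul_tmul, Algebra.TensorProduct.tmul_mul_tmul,
        Grassmann.mul_comm' hx hy, mul_comm s t]
      rcases Int.units_eq_one_or ((-1 : ℤˣ) ^ (i * j)) with h | h <;>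
        simp [h, Units.neg_smul, TensorProduct.tmul_neg]
    | add f g _ _ hf hg => rw [mul_add, hf, hg, add_mul, smul_add]
  | add f g _ _ hf hg => rw [add_mul, hf, hg, mul_add, smul_add]

theorem tmul_one_commute (s : Smooth V) (f : Model m V) : Commute (s ⊗ₜ[ℝ] (1 : Grassmann m)) f := by
  induction f using TensorProduct.induction_on with
  | zero => exact Commute.zero_right _
  | tmul t x =>
    rw [commute_iff_eq, Algebra.TensorProduct.tmul_mul_tmul, Algebra.TensorProduct.tmul_mul_tmul,
      mul_comm s t, one_mul, mul_one]
  | add f g hf hg => exact hf.add_right hg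

theorem coord_inl (μ : Fin n) :
    coord (m := m) V (.inl μ) = Smooth.coord V μ ⊗ₜ[ℝ] (1 : Grassmann m) := rfl

theorem coord_inr (i : Fin m) : coord (m := m) V (.inr i) =
    (1 : Smooth V) ⊗ₜ[ℝ] Grassmann.ι (Pi.single i (1 : ℝ)) := rfl

theorem pd_inl_tmul (μ : Fin n) (s : Smooth V) (x : Grassmann m) :
    pd V (.inl μ) (s ⊗ₜ x) = Smooth.partialDeriv V μ s ⊗ₜ x := rfl

theorem pd_inr_tmul (i : Fin m) (s : Smooth V) (x : Grassmann m) :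
    pd V (.inr i) (s ⊗ₜ x) = s ⊗ₜ Grassmann.contract (LinearMap.proj i) x := rfl

theorem coord_mem (a : Fin n ⊕ Fin m) : coord V a ∈ grading V (parity a) := by
  rcases a with μ | i
  · exact tmul_one_mem _
  · exact tmul_mem _ (Grassmann.ι_mem _)

theorem isSuperDerivation_pd (a : Fin n ⊕ Fin m) :
    IsSuperDerivation (grading V) (parity a) (pd V a) where
  mem := by
    intro i f hf
    induction f, hf using grading_induction with
    | tmul s x hx =>
      rcases a with μ | j
      · rw [parity, Sum.elim_inl, add_zero]
        exact tmul_mem (Smooth.partialDeriv V μ s) hx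
      · exact tmul_mem _ (Grassmann.contract_mem _ hx)
    | add f g _ _ hf hg => rw [map_add]; exact Submodule.add_mem _ hf hg
  leibniz := by
    intro i f g hf
    induction f, hf using grading_induction with
    | tmul s x hx =>
      induction g using TensorProduct.induction_on with
      | zero => simp
      | tmul t y =>
        rcases a with μ | j
        · simp only [Algebra.TensorProduct.tmul_mul_tmul, pd_inl_tmul, Smooth.partialDeriv_mul,
            TensorProduct.add_tmul, parity, Sum.elim_inl, zero_mul, uzpow_zero, one_smul]
        · simp only [Algebra.TensorProduct.tmul_mul_tmul, pd_inr_tmul, Grassmann.contract_mul',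
            Grassmann.invol_of_mem hx, TensorProduct.tmul_add, parity, Sum.elim_inr, one_mul]
          rcases Int.units_eq_one_or ((-1 : ℤˣ) ^ i) with h | h <;>
            simp [h, Units.neg_smul, TensorProduct.tmul_neg]
      | add g g' hg hg' => simp only [mul_add, map_add, hg, hg', smul_add]; abel
    | add f f' _ _ hf hf' => simp only [add_mul, map_add, hf, hf', smul_add]; abel

theorem pd_coord (a b : Fin n ⊕ Fin m) : pd V a (coord V b) = if a = b then 1 else 0 := by
  rcases a with μ | i <;> rcases b with ν | j
  · rw [coord_inl, pd_inl_tmul, Smooth.partialDeriv_coord]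
    by_cases h : μ = ν <;> simp [h, Algebra.TensorProduct.one_def]
  · rw [coord_inr, pd_inl_tmul, Smooth.partialDeriv_one]
    simp
  · rw [coord_inl, pd_inr_tmul, Grassmann.contract_one]
    simp
  · rw [coord_inr, pd_inr_tmul, Grassmann.contract_ι]
    by_cases h : i = j
    · simp [h, Algebra.TensorProduct.one_def]
    · simp [h]

theorem pd_comm (a b : Fin n ⊕ Fin m) (f : Model m V) :
    pd V a (pd V b f) = ((-1 : ℤˣ) ^ (parity a * parity b)) • pd V b (pd V a f) := by
  induction f using TensorProduct.induction_on with
  | zero => simp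
  | tmul s x =>
    rcases a with μ | i <;> rcases b with ν | j
    · simp [pd_inl_tmul, parity, Smooth.partialDeriv_comm μ ν]
    · simp [pd_inl_tmul, pd_inr_tmul, parity]
    · simp [pd_inl_tmul, pd_inr_tmul, parity]
    · simp only [pd_inr_tmul, parity, Sum.elim_inr, mul_one, uzpow_one, Units.neg_smul, one_smul,
        ← TensorProduct.tmul_neg]
      congr 1
      exact CliffordAlgebra.contractLeft_comm _ _ _
  | add f g hf hg => simp only [map_add, hf, hg, smul_add]

theorem res_tmul (h : W ≤ V) (s : Smooth V) (x : Grassmann m) :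
    res h (s ⊗ₜ x) = Smooth.res h s ⊗ₜ x := rfl

theorem pd_res (h : W ≤ V) (a : Fin n ⊕ Fin m) (f : Model m V) :
    pd W a (res h f) = res h (pd V a f) := by
  induction f using TensorProduct.induction_on with
  | zero => simp
  | tmul s x =>
    rcases a with μ | i
    · rw [res_tmul, pd_inl_tmul, pd_inl_tmul, res_tmul, Smooth.partialDeriv_res]
    · rfl
  | add f g hf hg => simp only [map_add, hf, hg]

theorem res_coord (h : W ≤ V) (a : Fin n ⊕ Fin m) : res h (coord V a) = coord W a := by
  rcases a with μ | i
  · rfl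
  · rw [coord_inr, res_tmul, _root_.map_one]; rfl

/-- Evaluation of the coefficients of a superfunction at a point. -/
noncomputable def eval (p : V) : Model m V →ₐ[ℝ] Grassmann m :=
  (Algebra.TensorProduct.lid ℝ (Grassmann m)).toAlgHom.comp
    (Algebra.TensorProduct.map (Smooth.eval p) (AlgHom.id ℝ (Grassmann m)))

theorem eval_tmul (p : V) (s : Smooth V) (x : Grassmann m) : eval p (s ⊗ₜ x) = s p • x := rfl

/-- The superfunctions form a free C^∞(V)-module on a basis of Λ, and smooth coefficients are
determined pointwise. -/
theorem ext_eval {f g : Model m V} (h : ∀ p, eval p f = eval p g) : f = g := by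
  let b := Module.Free.chooseBasis ℝ (Grassmann m)
  let B := Algebra.TensorProduct.basis (Smooth V) b
  have key : ∀ (f : Model m V) (p : V) (i), b.repr (eval p f) i = (B.repr f i) p := by
    intro f p i
    induction f using TensorProduct.induction_on with
    | zero => simp
    | tmul s x =>
      rw [eval_tmul, Algebra.TensorProduct.basis_repr_tmul, map_smul, Finsupp.smul_apply,
        Finsupp.smul_apply]
      rfl
    | add f g hf hg => simp only [map_add, Finsupp.add_apply, hf, hg]; rfl
  refine B.ext_elem fun i => ?_
  ext p
  rw [← key, ← key, h]

theorem body_tmul (s : Smooth V) (x : Grassmann m) : body V (s ⊗ₜ x) = Grassmann.aug x • s := rfl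

theorem body_tmul_one (s : Smooth V) : body V (s ⊗ₜ (1 : Grassmann m)) = s := by
  simp [body_tmul]

theorem body_apply (f : Model m V) (p : V) : body V f p = Grassmann.aug (eval p f) := by
  induction f using TensorProduct.induction_on with
  | zero => simp
  | tmul s x => rw [eval_tmul, body_tmul, map_smul, smul_eq_mul, mul_comm]; rfl
  | add f g hf hg => simp only [map_add, ← hf, ← hg]; rfl

theorem body_res (h : W ≤ V) (f : Model m V) : body W (res h f) = Smooth.res h (body V f) := by
  induction f using TensorProduct.induction_on with
  | zero => simp
  | tmul s x => rw [res_tmul, body_tmul, body_tmul, map_smul]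
  | add f g hf hg => simp only [map_add, hf, hg]

theorem eval_pd_inr (p : V) (i : Fin m) (f : Model m V) :
    eval p (pd V (.inr i) f) = Grassmann.contract (LinearMap.proj i) (eval p f) := by
  induction f using TensorProduct.induction_on with
  | zero => simp
  | tmul s x => rw [pd_inr_tmul, eval_tmul, eval_tmul, map_smul]
  | add f g hf hg => simp only [map_add, hf, hg]

/-- At each point, the difference has zero contractions and is thus a scalar, which is its body. -/
theorem ext_body_pd {f g : Model m V} (hb : body V f = body V g)
    (h : ∀ i, pd V (.inr i) f = pd V (.inr i) g) : f = g := by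
  rw [← sub_eq_zero]
  refine ext_eval fun p => ?_
  have h1 : eval p (f - g) = algebraMap ℝ _ (Grassmann.aug (eval p (f - g))) :=
    Grassmann.eq_algebraMap_of_contract_eq_zero fun i => by
      rw [← eval_pd_inr, map_sub, h, sub_self, map_zero]
  rw [h1, ← body_apply, map_sub, hb, sub_self, map_zero]
  exact map_zero _

theorem pow_eq_zero_of_body_eq_zero {f : Model m V} (hf : body V f = 0) : f ^ (m + 1) = 0 := by
  refine ext_eval fun p => ?_
  rw [map_pow, map_zero]
  refine Grassmann.pow_eq_zero_of_aug_eq_zero ?_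
  rw [← body_apply, hf]; rfl

/-- The body is a unit and the rest is nilpotent and commutes with it. -/
theorem isUnit_of_body_ne_zero {f : Model m V} (hf : ∀ p, body V f p ≠ 0) : IsUnit f := by
  have h1 : IsUnit (body V f ⊗ₜ[ℝ] (1 : Grassmann m)) :=
    (Smooth.isUnit_of_forall_ne_zero _ hf).map
      (Algebra.TensorProduct.includeLeft : Smooth V →ₐ[ℝ] Model m V)
  have h2 : IsNilpotent (f - body V f ⊗ₜ[ℝ] (1 : Grassmann m)) :=
    ⟨m + 1, pow_eq_zero_of_body_eq_zero (by rw [map_sub, body_tmul_one, sub_self])⟩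
  have h3 := h2.isUnit_add_left_of_commute h1 (tmul_one_commute _ _).symm
  rwa [add_sub_cancel] at h3

/-! ### The chain rule -/

section ChainRule

variable {p : ZMod 2} {D : Model m V →ₗ[ℝ] Model m V} (hD : IsSuperDerivation (grading V) p D)
include hD

/-- Every coefficient of D(s ⊗ 1), evaluated at a point, is a point derivation in s, whatever the
parity of D, since s ⊗ 1 is even. -/
theorem derivation_tmul_one (s : Smooth V) : D (s ⊗ₜ (1 : Grassmann m)) =
    ∑ μ, D (coord V (.inl μ)) * (Smooth.partialDeriv V μ s ⊗ₜ (1 : Grassmann m)) := by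
  refine ext_eval fun x => ?_
  let b := Module.Free.chooseBasis ℝ (Grassmann m)
  refine b.ext_elem fun i => ?_
  have h := Smooth.pointDerivation_eq_sum x (b.coord i ∘ₗ (eval x).toLinearMap ∘ₗ D ∘ₗ
    (TensorProduct.mk ℝ (Smooth V) (Grassmann m)).flip 1) ?_ s
  · refine h.trans ?_
    rw [map_sum, map_sum, Finsupp.finsetSum_apply]
    refine Finset.sum_congr rfl fun μ _ => ?_
    rw [map_mul, eval_tmul, mul_smul_comm, mul_one, map_smul]
    rfl
  · intro f g
    have h1 : D ((f * g) ⊗ₜ (1 : Grassmann m)) = D (f ⊗ₜ (1 : Grassmann m)) * (g ⊗ₜ 1) +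
        f ⊗ₜ 1 * D (g ⊗ₜ (1 : Grassmann m)) := by
      rw [← hD.leibniz_zero _ (tmul_one_mem f), Algebra.TensorProduct.tmul_mul_tmul, one_mul]
    change b.repr (eval x (D ((f * g) ⊗ₜ (1 : Grassmann m)))) i = f x * b.repr (eval x (D (g ⊗ₜ 1))) i
      + g x * b.repr (eval x (D (f ⊗ₜ 1))) i
    rw [h1, map_add, map_mul, map_mul, eval_tmul, eval_tmul, mul_smul_comm, smul_mul_assoc, one_mul,
      mul_one, map_add, map_smul, map_smul, add_comm]
    rfl

/-- Induction on left multiplication by generators: the sign from D passing ξ and the sign from ξ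
passing D(ξ^i) combine to the minus sign in the Leibniz rule of the contraction. -/
theorem derivation_one_tmul (x : Grassmann m) : D ((1 : Smooth V) ⊗ₜ x) =
    ∑ i, D (coord V (.inr i)) * ((1 : Smooth V) ⊗ₜ Grassmann.contract (LinearMap.proj i) x) := by
  have h0 : D 1 = 0 := hD.map_one (tmul_one_mem 1)
  have hι (v : Fin m → ℝ) : D ((1 : Smooth V) ⊗ₜ Grassmann.ι v) =
      ∑ i, v i • D (coord V (.inr i)) := by
    rw [Grassmann.ι_eq_sum, TensorProduct.tmul_sum, map_sum]
    simp only [TensorProduct.tmul_smul, map_smul]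
    rfl
  induction x using Grassmann.left_induction with
  | one r =>
    have h1 : D ((1 : Smooth V) ⊗ₜ[ℝ] algebraMap ℝ (Grassmann m) r) = 0 := by
      rw [Algebra.algebraMap_eq_smul_one, TensorProduct.tmul_smul, map_smul,
        ← Algebra.TensorProduct.one_def, h0, smul_zero]
    rw [h1]
    refine (Finset.sum_eq_zero fun i _ => ?_).symm
    rw [Grassmann.contract_algebraMap, TensorProduct.tmul_zero, mul_zero]
  | add x y hx hy =>
    simp only [TensorProduct.tmul_add, map_add, hx, hy, mul_add, Finset.sum_add_distrib]
  | ι_mul x v hx =>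
    have h1 : (1 : Smooth V) ⊗ₜ[ℝ] (Grassmann.ι v * x) = (1 ⊗ₜ Grassmann.ι v) * (1 ⊗ₜ x) := by
      rw [Algebra.TensorProduct.tmul_mul_tmul, one_mul]
    rw [h1, hD.leibniz _ (tmul_mem 1 (Grassmann.ι_mem v)), hι, hx, Finset.sum_mul, Finset.mul_sum,
      Finset.smul_sum, ← Finset.sum_add_distrib]
    refine Finset.sum_congr rfl fun i _ => ?_
    have h2 := mul_comm' (tmul_mem 1 (Grassmann.ι_mem v))
      (hD.mem (coord_mem (V := V) (.inr i : Fin n ⊕ Fin m)))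
    rw [Grassmann.contract_ι_mul, TensorProduct.tmul_sub, TensorProduct.tmul_smul, mul_sub,
      mul_smul_comm, smul_mul_assoc, sub_eq_add_neg]
    congr 1
    have h3 : (1 : Smooth V) ⊗ₜ[ℝ] (Grassmann.ι v * Grassmann.contract (LinearMap.proj i) x) =
        (1 ⊗ₜ Grassmann.ι v) * (1 ⊗ₜ Grassmann.contract (LinearMap.proj i) x) := by
      rw [Algebra.TensorProduct.tmul_mul_tmul, one_mul]
    rw [h3, ← mul_assoc, ← mul_assoc, h2]
    rcases zmod_two_cases p with rfl | rfl
    · simp only [parity, Sum.elim_inr, add_zero, mul_one, uzpow_one, uzpow_zero,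
        Units.neg_smul, one_smul]
      exact neg_mul (α := Model m V) _ _
    · simp [parity, Units.neg_smul, (by decide : (1 + 1 : ZMod 2) = 0)]

theorem derivation_eq_sum (f : Model m V) : D f = ∑ a, D (coord V a) * pd V a f := by
  induction f using TensorProduct.induction_on with
  | zero => simp
  | tmul s x =>
    have h1 : s ⊗ₜ[ℝ] x = (s ⊗ₜ 1) * (1 ⊗ₜ x) := by
      rw [Algebra.TensorProduct.tmul_mul_tmul, mul_one, one_mul]
    conv_lhs => rw [h1, hD.leibniz_zero _ (tmul_one_mem s), derivation_tmul_one hD,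
      derivation_one_tmul hD]
    rw [Fintype.sum_sum_type, Finset.sum_mul, Finset.mul_sum]
    congr 1
    · refine Finset.sum_congr rfl fun μ _ => ?_
      rw [pd_inl_tmul, mul_assoc, Algebra.TensorProduct.tmul_mul_tmul, mul_one, one_mul]
    · refine Finset.sum_congr rfl fun i _ => ?_
      rw [pd_inr_tmul, ← mul_assoc, (tmul_one_commute s _).eq, mul_assoc,
        Algebra.TensorProduct.tmul_mul_tmul, mul_one, one_mul]
  | add f g hf hg => simp only [map_add, hf, hg, mul_add, Finset.sum_add_distrib]

theorem derivation_comp (F : ℝ → ℝ) (s s' : Smooth V) (hF : ∀ x, ContDiffAt ℝ ∞ F (s x))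
    (hs' : ∀ x, s' x = deriv F (s x)) :
    D (Smooth.comp F s hF ⊗ₜ (1 : Grassmann m)) = D (s ⊗ₜ (1 : Grassmann m)) * (s' ⊗ₜ 1) := by
  rw [derivation_tmul_one hD, derivation_tmul_one hD s, Finset.sum_mul]
  refine Finset.sum_congr rfl fun μ _ => ?_
  rw [mul_assoc, Algebra.TensorProduct.tmul_mul_tmul, mul_one]
  congr 2
  ext x
  rw [Smooth.partialDeriv_comp, ← hs', mul_comm]
  rfl

end ChainRule

end Model

/-! ### Derivatives of truncated exponential and logarithm series of nilpotent elements -/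

namespace IsSuperDerivation

variable {R : Type*} [Ring R] [Algebra ℝ R] {𝒜 : ZMod 2 → Submodule ℝ R}
  [SetLike.GradedMonoid 𝒜] {p : ZMod 2} {D : R →ₗ[ℝ] R}

/-- This is D(w^(m+1)) = 0 divided by m + 1. It kills the boundary terms left by truncating the
series at the nilpotency order. -/
theorem apply_mul_pow_eq_zero (hD : IsSuperDerivation 𝒜 p D) {w : R} (hw : w ∈ 𝒜 0)
    (hc : Commute w (D w)) {m : ℕ} (hm : w ^ (m + 1) = 0) : D w * w ^ m = 0 := by
  have h := hD.pow_succ' hw hc m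
  rw [hm, map_zero, eq_comm, smul_eq_zero] at h
  exact h.resolve_left (by positivity)

theorem apply_sum_exp (hD : IsSuperDerivation 𝒜 p D) {w : R} (hw : w ∈ 𝒜 0)
    (hc : Commute w (D w)) {m : ℕ} (hm : w ^ (m + 1) = 0) :
    D (∑ k ∈ Finset.range (m + 1), ((k.factorial : ℝ)⁻¹) • w ^ k) =
      D w * ∑ k ∈ Finset.range (m + 1), ((k.factorial : ℝ)⁻¹) • w ^ k := by
  conv_lhs => rw [Finset.sum_range_succ']
  conv_rhs => rw [Finset.sum_range_succ]
  rw [mul_add, mul_smul_comm,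
    hD.apply_mul_pow_eq_zero hw hc hm, smul_zero, add_zero, map_add, pow_zero, map_smul,
    hD.map_one (SetLike.one_mem_graded 𝒜), smul_zero, add_zero, map_sum, Finset.mul_sum]
  refine Finset.sum_congr rfl fun k _ => ?_
  rw [map_smul, hD.pow_succ' hw hc, smul_smul, mul_smul_comm, Nat.factorial_succ]
  congr 1
  push_cast
  field_simp

/-- Differentiating the truncated series of log(1 + w) gives a finite geometric series in -w, which
telescopes against 1 + w. -/
theorem apply_sum_log_mul (hD : IsSuperDerivation 𝒜 p D) {w : R} (hw : w ∈ 𝒜 0)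
    (hc : Commute w (D w)) {m : ℕ} (hm : w ^ (m + 1) = 0) :
    D (∑ k ∈ Finset.range m, ((-1) ^ k / (k + 1) : ℝ) • w ^ (k + 1)) * (1 + w) = D w := by
  have h1 : D (∑ k ∈ Finset.range m, ((-1) ^ k / (k + 1) : ℝ) • w ^ (k + 1)) =
      D w * ∑ k ∈ Finset.range m, (-w) ^ k := by
    rw [map_sum, Finset.mul_sum]
    refine Finset.sum_congr rfl fun k _ => ?_
    rw [map_smul, hD.pow_succ' hw hc, smul_smul, div_mul_cancel₀ _ (by positivity)]
    rcases Nat.even_or_odd k with hk | hk <;> simp [hk.neg_one_pow, hk.neg_pow]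
  have h2 : 1 + w = 1 - -w := by rw [sub_neg_eq_add]
  rw [h1, h2, mul_assoc, geom_sum_mul_neg, mul_sub, mul_one, neg_pow]
  rcases neg_one_pow_eq_or R m with h | h <;>
    simp [h, hD.apply_mul_pow_eq_zero hw hc hm]

end IsSuperDerivation

/-! ### Exponential and logarithm of even superfunctions on a superdomain -/

namespace Model

variable {n m : ℕ} {V W : Opens (Euc n)}

theorem commute_of_even {f g : Model m V} {i : ZMod 2} (hf : f ∈ grading V 0)
    (hg : g ∈ grading V i) : Commute f g := by
  have h := mul_comm' hf hg
  rwa [zero_mul, uzpow_zero, one_smul] at h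

/-- The nilpotent part of a superfunction. -/
noncomputable def nil (f : Model m V) : Model m V := f - body V f ⊗ₜ[ℝ] (1 : Grassmann m)

theorem body_nil (f : Model m V) : body V (nil f) = 0 := by
  rw [nil, map_sub, body_tmul_one, sub_self]

theorem body_add_nil (f : Model m V) : body V f ⊗ₜ[ℝ] (1 : Grassmann m) + nil f = f :=
  add_sub_cancel _ _

theorem nil_mem {f : Model m V} (hf : f ∈ grading V 0) : nil f ∈ grading V 0 :=
  Submodule.sub_mem _ hf (tmul_one_mem _)

theorem body_exp (g : Model m V) : body V (exp g) = Smooth.exp (body V g) := by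
  change body V (_ * ∑ k ∈ Finset.range (m + 1), ((k.factorial : ℝ)⁻¹) • nil g ^ k) = _
  rw [map_mul, body_tmul_one, map_sum]
  simp [body_nil, Finset.sum_range_succ']

theorem exp_mem {g : Model m V} (hg : g ∈ grading V 0) : exp g ∈ grading V 0 := by
  have h : ∑ k ∈ Finset.range (m + 1), ((k.factorial : ℝ)⁻¹) • nil g ^ k ∈ grading V 0 := by
    refine Submodule.sum_mem _ fun k _ => Submodule.smul_mem _ _ ?_
    have := SetLike.pow_mem_graded k (nil_mem hg)
    rwa [smul_zero] at this
  have h2 := mul_mem (tmul_one_mem (Smooth.exp (body V g))) h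
  rwa [add_zero] at h2

theorem isUnit_exp (g : Model m V) : IsUnit (exp g) :=
  isUnit_of_body_ne_zero fun p => by rw [body_exp]; exact (Real.exp_pos _).ne'

theorem derivation_exp {p : ZMod 2} {D : Model m V →ₗ[ℝ] Model m V}
    (hD : IsSuperDerivation (grading V) p D) {g : Model m V} (hg : g ∈ grading V 0) :
    D (exp g) = D g * exp g := by
  set e := Smooth.exp (body V g) ⊗ₜ[ℝ] (1 : Grassmann m) with he
  set S := ∑ k ∈ Finset.range (m + 1), ((k.factorial : ℝ)⁻¹) • nil g ^ k with hS
  have h1 : exp g = e * S := rfl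
  have h2 : D e = D (body V g ⊗ₜ (1 : Grassmann m)) * e :=
    derivation_comp hD Real.exp (body V g) (Smooth.exp (body V g))
      (fun x => Real.contDiff_exp.contDiffAt) fun x => by rw [Real.deriv_exp]; rfl
  have h3 : D S = D (nil g) * S :=
    hD.apply_sum_exp (nil_mem hg) (commute_of_even (nil_mem hg) (hD.mem (nil_mem hg)))
      (pow_eq_zero_of_body_eq_zero (body_nil g))
  have hgD : D g = D (body V g ⊗ₜ (1 : Grassmann m)) + D (nil g) := by
    rw [← map_add, body_add_nil]
  rw [h1, hD.leibniz_zero _ (tmul_one_mem _), h2, h3, hgD, add_mul, mul_assoc]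
  congr 1
  rw [← mul_assoc, ← mul_assoc, (tmul_one_commute _ _).eq]

/-- The logarithm of the absolute value of an even superfunction with invertible body. -/
theorem exists_log {h : Model m V} (hh : h ∈ grading V 0) (h0 : ∀ x, body V h x ≠ 0) :
    ∃ g ∈ grading V 0, (∀ x, body V g x = Real.log (body V h x)) ∧
      ∀ (p : ZMod 2) (D : Model m V →ₗ[ℝ] Model m V), IsSuperDerivation (grading V) p D →
        D g * h = D h := by
  set b := body V h with hb
  let i : Smooth V := Smooth.comp (fun t => t⁻¹) b fun x => contDiffAt_inv ℝ (h0 x)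
  -- `Real.log` is log|t|, with derivative 1/t for either sign of t; the body only needs to be
  -- nonzero.
  let l : Smooth V := Smooth.comp Real.log b fun x => Real.contDiffAt_log.2 (h0 x)
  have hib : i * b = 1 := by ext x; exact inv_mul_cancel₀ (h0 x)
  set w := i ⊗ₜ[ℝ] (1 : Grassmann m) * nil h with hw
  have hw0 : w ∈ grading V 0 := by
    have := mul_mem (tmul_one_mem (m := m) i) (nil_mem hh)
    rwa [add_zero] at this
  have hwm : w ^ (m + 1) = 0 := pow_eq_zero_of_body_eq_zero (by
    rw [hw, map_mul, body_nil, mul_zero])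
  have hibt : i ⊗ₜ[ℝ] (1 : Grassmann m) * b ⊗ₜ 1 = 1 := by
    rw [Algebra.TensorProduct.tmul_mul_tmul, hib, mul_one, Algebra.TensorProduct.one_def]
  -- Factor h as b(1 + w), with w nilpotent; the logarithm is then log|b| plus the finite series of
  -- log(1 + w).
  have hhw : h = b ⊗ₜ (1 : Grassmann m) * (1 + w) := by
    rw [mul_add, mul_one, hw, ← mul_assoc, ← (tmul_one_commute i _).eq, hibt, one_mul]
    exact (body_add_nil h).symm
  refine ⟨l ⊗ₜ 1 + ∑ k ∈ Finset.range m, ((-1) ^ k / (k + 1) : ℝ) • w ^ (k + 1), ?_, ?_, ?_⟩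
  · refine Submodule.add_mem _ (tmul_one_mem _) (Submodule.sum_mem _ fun k _ =>
      Submodule.smul_mem _ _ ?_)
    have := SetLike.pow_mem_graded (k + 1) hw0
    rwa [smul_zero] at this
  · intro x
    have hbw : body V w = 0 := by rw [hw, map_mul, body_nil, mul_zero]
    rw [map_add, body_tmul_one, map_sum, Finset.sum_eq_zero fun k _ => ?_, add_zero]
    · rfl
    · rw [map_smul, map_pow, hbw, zero_pow k.succ_ne_zero, smul_zero]
  · intro p D hD
    have h1 : D (l ⊗ₜ (1 : Grassmann m)) = D (b ⊗ₜ (1 : Grassmann m)) * i ⊗ₜ 1 :=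
      derivation_comp hD Real.log b i _ fun x => by rw [Real.deriv_log]; rfl
    have h2 := hD.apply_sum_log_mul hw0 (commute_of_even hw0 (hD.mem hw0)) hwm
    have h3 : D (1 + w) = D w := by
      rw [map_add, hD.map_one (SetLike.one_mem_graded (grading V)), zero_add]
    rw [map_add, add_mul, h1]
    conv_rhs => rw [hhw, hD.leibniz_zero _ (tmul_one_mem _), h3, ← h2]
    congr 1
    · rw [hhw, mul_assoc, ← mul_assoc (i ⊗ₜ 1), hibt, one_mul]
    · conv_lhs => rw [hhw, ← mul_assoc, ← (tmul_one_commute b _).eq, mul_assoc]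

end Model

/-! ### The logarithmic derivative of the Berezinian -/

/-- Supercommutativity of a `ℤ/2`-graded algebra. -/
def IsSuperComm {R : Type*} [Ring R] [Algebra ℝ R] (𝒜 : ZMod 2 → Submodule ℝ R) : Prop :=
  ∀ (i j : ZMod 2) (f g : R), f ∈ 𝒜 i → g ∈ 𝒜 j → f * g = ((-1 : ℤˣ) ^ (i * j)) • (g * f)

/-! ### Matrices and traces over a supercommutative algebra -/

section Matrix

variable {R : Type*} [Ring R] [Algebra ℝ R] {𝒜 : ZMod 2 → Submodule ℝ R}

theorem IsSuperComm.commute (hc : IsSuperComm 𝒜) {j : ZMod 2} {f g : R} (hf : f ∈ 𝒜 0)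
    (hg : g ∈ 𝒜 j) : Commute f g := by
  have h := hc 0 j f g hf hg
  rwa [zero_mul, uzpow_zero, one_smul] at h

theorem IsSuperComm.mul_self (hc : IsSuperComm 𝒜) {f : R} (hf : f ∈ 𝒜 1) : f * f = 0 := by
  have h := hc 1 1 f f hf hf
  rw [mul_one, uzpow_one, Units.neg_smul, one_smul] at h
  have h2 : (2 : ℝ) • (f * f) = 0 := by
    rw [two_smul]
    nth_rewrite 1 [h]
    exact neg_add_cancel _
  exact (smul_eq_zero.1 h2).resolve_left two_ne_zero

theorem IsSuperComm.commute_all [GradedAlgebra 𝒜] (hc : IsSuperComm 𝒜) {f : R} (hf : f ∈ 𝒜 0)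
    (g : R) : Commute f g := by
  induction g using DirectSum.Decomposition.inductionOn 𝒜 with
  | zero => exact Commute.zero_right _
  | homogeneous g => exact hc.commute hf g.2
  | add g g' h h' => exact h.add_right h'

/-- Matrices with homogeneous entries of parity `i`. -/
def HasParity {α β : Type*} (𝒜 : ZMod 2 → Submodule ℝ R) (i : ZMod 2) (X : Matrix α β R) : Prop :=
  ∀ a b, X a b ∈ 𝒜 i

theorem HasParity.mul [SetLike.GradedMonoid 𝒜] {α β γ : Type*} [Fintype β] {i j : ZMod 2}
    {X : Matrix α β R} {Y : Matrix β γ R} (hX : HasParity 𝒜 i X) (hY : HasParity 𝒜 j Y) :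
    HasParity 𝒜 (i + j) (X * Y) := fun a c => by
  rw [Matrix.mul_apply]
  exact Submodule.sum_mem _ fun b _ => SetLike.mul_mem_graded (hX a b) (hY b c)

theorem HasParity.map {α β : Type*} {i p : ZMod 2} {X : Matrix α β R} (hX : HasParity 𝒜 i X)
    {D : R →ₗ[ℝ] R} (hD : IsSuperDerivation 𝒜 p D) : HasParity 𝒜 (i + p) (X.map D) :=
  fun a b => hD.mem (hX a b)

theorem trace_mul_comm_of_even {α β : Type*} [Fintype α] [Fintype β] (hc : IsSuperComm 𝒜)
    {j : ZMod 2} {X : Matrix α β R} {Y : Matrix β α R} (hX : HasParity 𝒜 0 X)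
    (hY : HasParity 𝒜 j Y) : (X * Y).trace = (Y * X).trace := by
  simp only [Matrix.trace, Matrix.diag_apply, Matrix.mul_apply]
  rw [Finset.sum_comm]
  exact Finset.sum_congr rfl fun b _ => Finset.sum_congr rfl fun a _ =>
    (hc.commute (hX a b) (hY b a)).eq

theorem IsSuperDerivation.matrix_mul {α β γ : Type*} [Fintype β] {i p : ZMod 2} {D : R →ₗ[ℝ] R}
    (hD : IsSuperDerivation 𝒜 p D) {X : Matrix α β R} (hX : HasParity 𝒜 i X) (Y : Matrix β γ R) :
    (X * Y).map D = X.map D * Y + ((-1 : ℤˣ) ^ (p * i)) • (X * Y.map D) := by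
  ext a c
  simp only [Matrix.map_apply, Matrix.mul_apply, map_sum, Matrix.add_apply, Matrix.smul_apply,
    Finset.smul_sum, ← Finset.sum_add_distrib]
  exact Finset.sum_congr rfl fun b _ => hD.leibniz _ (hX a b)

/-- The logarithmic derivative of the Berezinian, as an identity between traces of blocks. -/
theorem trace_blocks [SetLike.GradedMonoid 𝒜] {α β : Type*} [Fintype α] [Fintype β] [DecidableEq α]
    [DecidableEq β] (hc : IsSuperComm 𝒜) {q : R →ₗ[ℝ] R} (hq : IsSuperDerivation 𝒜 1 q)
    {A T : Matrix α α R} {B : Matrix α β R} {C : Matrix β α R} {D D' : Matrix β β R}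
    (hB : HasParity 𝒜 1 B) (hC : HasParity 𝒜 1 C)
    (hD' : HasParity 𝒜 0 D') (hT : HasParity 𝒜 0 T) (hDD' : D * D' = 1) (hD'D : D' * D = 1)
    (hD : HasParity 𝒜 0 D) :
    (T * (A - B * D' * C).map q).trace + (D * D'.map q).trace =
      (T * A.map q).trace + (-(D' * C * T) * B.map q).trace - (-(T * B * D') * C.map q).trace -
        ((D' + D' * C * T * B * D') * D.map q).trace := by
  have h1 : (B * D' * C).map q = B.map q * D' * C - B * D'.map q * C - B * D' * C.map q := by
    rw [hq.matrix_mul (i := 1) (by simpa using hB.mul hD'), hq.matrix_mul hB]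
    simp only [mul_one, uzpow_one, Units.neg_smul, one_smul, Matrix.add_mul, Matrix.neg_mul]
    abel
  have h1q : q 1 = 0 := hq.map_one (SetLike.one_mem_graded 𝒜)
  have h2 : D'.map q = -(D' * D.map q * D') := by
    have h3 := hq.matrix_mul hD' D
    rw [hD'D, mul_zero, uzpow_zero, one_smul] at h3
    have h4 : (1 : Matrix β β R).map q = 0 := by
      ext a b
      by_cases h : a = b <;> simp [h, h1q]
    rw [h4] at h3
    have h5 : (D'.map q * D + D' * D.map q) * D' = 0 := by rw [← h3, Matrix.zero_mul]
    rw [Matrix.add_mul, Matrix.mul_assoc _ D, hDD', Matrix.mul_one] at h5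
    exact eq_neg_of_add_eq_zero_left h5
  have h3 : (A - B * D' * C).map q = A.map q - (B * D' * C).map q := Matrix.map_sub _ (map_sub q) _ _
  -- Both T and q(B) have even entries, so cyclicity of the trace holds without a sign; the same
  -- device gives `e2` and `e3`.
  have e1 : (T * (B.map q * D' * C)).trace = (D' * C * T * B.map q).trace := by
    have h := trace_mul_comm_of_even hc (j := 1) (X := T * B.map q) (Y := D' * C)
      (by simpa [(by decide : (1 + 1 : ZMod 2) = 0)] using hT.mul (hB.map hq))
      (by simpa using hD'.mul hC)
    simpa only [Matrix.mul_assoc] using h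
  have e2 : (T * (B * (D' * D.map q * D') * C)).trace = (D' * C * T * B * D' * D.map q).trace := by
    have h := trace_mul_comm_of_even hc (j := 1) (X := T * B * D' * D.map q) (Y := D' * C)
      (by simpa [(by decide : (1 + 1 : ZMod 2) = 0)] using
        ((hT.mul hB).mul hD').mul (hD.map hq))
      (by simpa using hD'.mul hC)
    simpa only [Matrix.mul_assoc] using h
  have e3 : (D * (D' * D.map q * D')).trace = (D' * D.map q).trace := by
    have h := trace_mul_comm_of_even hc (j := 1) (X := D') (Y := D.map q) hD'
      (by simpa using hD.map hq)
    rw [h, Matrix.mul_assoc, ← Matrix.mul_assoc D, hDD', Matrix.one_mul]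
  rw [h3, h1, h2]
  simp only [Matrix.mul_assoc] at e1 e2 e3
  simp only [Matrix.mul_sub, Matrix.mul_add, Matrix.add_mul, Matrix.neg_mul, Matrix.mul_neg,
    Matrix.trace_sub, Matrix.trace_add, Matrix.trace_neg, Matrix.mul_assoc, sub_neg_eq_add]
  rw [e1, e2, e3]
  abel

end Matrix

/-! ### Jacobi's formula for superderivations -/

section Det

variable {E R : Type*} [CommRing E] [Ring R] [Algebra ℝ R] {𝒜 : ZMod 2 → Submodule ℝ R}

theorem IsSuperDerivation.map_prod (i : E →+* R) (hi : ∀ e, i e ∈ 𝒜 0) [SetLike.GradedMonoid 𝒜]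
    (hc : IsSuperComm 𝒜) {p : ZMod 2} {D : R →ₗ[ℝ] R} (hD : IsSuperDerivation 𝒜 p D)
    {α : Type*} [DecidableEq α] (s : Finset α) (f : α → E) :
    D (i (∏ a ∈ s, f a)) = ∑ a ∈ s, i (∏ b ∈ s.erase a, f b) * D (i (f a)) := by
  induction s using Finset.induction_on with
  | empty => simpa using hD.map_one (SetLike.one_mem_graded 𝒜)
  | insert a s ha ih =>
    rw [Finset.prod_insert ha, map_mul, hD.leibniz_zero _ (hi _), ih, Finset.sum_insert ha,
      Finset.erase_insert ha, (hc.commute (hi _) (hD.mem (hi _))).eq, Finset.mul_sum]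
    congr 1
    refine Finset.sum_congr rfl fun b hb => ?_
    have hba : a ≠ b := fun h => ha (h ▸ hb)
    rw [Finset.erase_insert_of_ne hba, Finset.prod_insert (fun h => ha (Finset.mem_of_mem_erase h)),
      map_mul, mul_assoc]

/-- The determinant is expanded over permutations. The derivation takes values in R rather than in
the commutative ring E, but even entries commute with these values, so the classical computation
goes through. -/
theorem IsSuperDerivation.map_det (i : E →+* R) (hi : ∀ e, i e ∈ 𝒜 0) [SetLike.GradedMonoid 𝒜]
    (hc : IsSuperComm 𝒜) {p : ZMod 2} {D : R →ₗ[ℝ] R} (hD : IsSuperDerivation 𝒜 p D)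
    {α : Type*} [DecidableEq α] [Fintype α] (S : Matrix α α E) :
    D (i S.det) = (S.adjugate.map i * (S.map i).map D).trace := by
  -- The permutations that contribute to the adjugate entry at (b, a) are those sending b to a.
  have hadj (b a : α) : S.adjugate b a = ∑ σ : Equiv.Perm α, Equiv.Perm.sign σ •
      if σ b = a then ∏ k ∈ Finset.univ.erase b, S (σ k) k else 0 := by
    rw [Matrix.adjugate_apply, Matrix.det_apply]
    refine Finset.sum_congr rfl fun σ _ => ?_
    congr 1
    split_ifs with h
    · rw [← Finset.mul_prod_erase _ _ (Finset.mem_univ b), h, Matrix.updateRow_self,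
        Pi.single_eq_same, one_mul]
      refine Finset.prod_congr rfl fun k hk => ?_
      rw [Matrix.updateRow_ne]
      rw [← h]
      exact fun h' => Finset.ne_of_mem_erase hk (σ.injective h')
    · refine Finset.prod_eq_zero (Finset.mem_univ (σ.symm a)) ?_
      rw [σ.apply_symm_apply, Matrix.updateRow_self, Pi.single_eq_of_ne]
      rintro rfl
      simp at h
  have hlhs : D (i S.det) = ∑ σ : Equiv.Perm α, Equiv.Perm.sign σ •
      ∑ b, i (∏ k ∈ Finset.univ.erase b, S (σ k) k) * D (i (S (σ b) b)) := by
    rw [Matrix.det_apply, map_sum, map_sum]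
    refine Finset.sum_congr rfl fun σ _ => ?_
    rw [Units.smul_def, map_zsmul, map_zsmul, hD.map_prod i hi hc, ← Units.smul_def]
  rw [hlhs]
  simp only [Matrix.trace, Matrix.diag_apply, Matrix.mul_apply, Matrix.map_apply, hadj, map_sum,
    Finset.sum_mul, Finset.smul_sum]
  rw [Finset.sum_comm]
  refine Finset.sum_congr rfl fun b _ => ?_
  rw [Finset.sum_comm]
  refine Finset.sum_congr rfl fun σ _ => ?_
  rw [Finset.sum_eq_single (σ b)]
  · rw [if_pos rfl, Units.smul_def, Units.smul_def, map_zsmul, smul_mul_assoc]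
  · intro a _ ha
    rw [if_neg ha.symm, smul_zero, map_zero, zero_mul]
  · simp

end Det

/-! ### The Berezinian and its derivative along an odd derivation -/

section Berezinian

variable {E R : Type*} [CommRing E] [Ring R] [Algebra ℝ R] {𝒜 : ZMod 2 → Submodule ℝ R}
  {n m : ℕ}

theorem isNilpotent_mul_of_odd (hc : IsSuperComm 𝒜) {f g : R} (hf : f ∈ 𝒜 1) (hg : g ∈ 𝒜 1) :
    IsNilpotent (f * g) := by
  refine ⟨2, ?_⟩
  have h := hc 1 1 g f hg hf
  rw [mul_one, uzpow_one, Units.neg_smul, one_smul] at h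
  rw [pow_two, mul_assoc, ← mul_assoc g, h, neg_mul, mul_assoc, hc.mul_self hg, mul_zero, neg_zero,
    mul_zero]

/-- Modulo the nilradical the matrix is the identity, so its determinant is 1 plus a nilpotent. -/
theorem isUnit_det_one_sub_of_isNilpotent {β : Type*} [Fintype β] [DecidableEq β] (N : Matrix β β E)
    (hN : ∀ a b, IsNilpotent (N a b)) : IsUnit (1 - N).det := by
  have h1 : (Ideal.Quotient.mk (nilradical E)).mapMatrix (1 - N) = 1 := by
    have h2 : (Ideal.Quotient.mk (nilradical E)).mapMatrix N = 0 := by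
      ext a b
      exact Ideal.Quotient.eq_zero_iff_mem.2 (hN a b)
    rw [map_sub, h2, map_one, sub_zero]
  have h2 : Ideal.Quotient.mk (nilradical E) ((1 - N).det - 1) = 0 := by
    rw [map_sub, RingHom.map_det, h1, Matrix.det_one, map_one, sub_self]
  have h3 : IsNilpotent ((1 - N).det - 1) := Ideal.Quotient.eq_zero_iff_mem.1 h2
  simpa using h3.isUnit_one_add

theorem adjugate_eq_smul {β : Type*} [Fintype β] [DecidableEq β] {X Y : Matrix β β E}
    (h : X * Y = 1) : X.adjugate = X.det • Y := by
  rw [← Matrix.mul_one X.adjugate, ← h, ← Matrix.mul_assoc, Matrix.adjugate_mul, Matrix.smul_mul,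
    Matrix.one_mul]

/-- The data identifying a commutative ring `E` with the even part of a graded algebra. -/
structure IsEvenPart (𝒜 : ZMod 2 → Submodule ℝ R) (i : E →+* R) (ev : R → E) : Prop where
  injective : Function.Injective i
  mem : ∀ e, i e ∈ 𝒜 0
  apply_ev : ∀ {f}, f ∈ 𝒜 0 → i (ev f) = f

namespace IsEvenPart

variable {i : E →+* R} {ev : R → E} (h : IsEvenPart 𝒜 i ev)
include h

theorem map_map {α β : Type*} {X : Matrix α β R} (hX : HasParity 𝒜 0 X) : (X.map ev).map i = X := by
  ext a b
  exact h.apply_ev (hX a b)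

theorem matrix_ext {α β : Type*} {X Y : Matrix α β E} (hXY : X.map i = Y.map i) : X = Y :=
  Matrix.map_injective h.injective hXY

theorem hasParity {α β : Type*} (X : Matrix α β E) : HasParity 𝒜 0 (X.map i) :=
  fun a b => h.mem (X a b)

theorem deriv_det [SetLike.GradedMonoid 𝒜] (hc : IsSuperComm 𝒜) {p : ZMod 2} {q : R →ₗ[ℝ] R}
    (hq : IsSuperDerivation 𝒜 p q) {β : Type*} [Fintype β] [DecidableEq β] {X Y : Matrix β β E}
    (hXY : X * Y = 1) : q (i X.det) = i X.det * (Y.map i * (X.map i).map q).trace := by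
  rw [hq.map_det i h.mem hc, adjugate_eq_smul hXY]
  simp only [Matrix.trace, Matrix.diag_apply, Matrix.mul_apply, Matrix.map_apply, Matrix.smul_apply,
    smul_eq_mul, map_mul, Finset.mul_sum, mul_assoc]

end IsEvenPart

/-- The Berezinian over a commutative ring identified with the even part. -/
noncomputable def ber (i : E →+* R) (ev : R → E) (J : Matrix (Fin n ⊕ Fin m) (Fin n ⊕ Fin m) R) : R :=
  i (((J.toBlocks₁₁ - J.toBlocks₁₂ * ((J.toBlocks₂₂.map ev)⁻¹).map i * J.toBlocks₂₁).map ev).det *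
    ((J.toBlocks₂₂.map ev)⁻¹).det)

/-- Jacobi's formula is applied to the two determinants of the Berezinian. The blocks of K are
expressed through D⁻¹ and the inverse of the Schur complement S, and `trace_blocks` regroups the
traces into the signed sum. -/
theorem IsEvenPart.deriv_ber [SetLike.GradedMonoid 𝒜] {i : E →+* R} {ev : R → E}
    (h : IsEvenPart 𝒜 i ev) (hc : IsSuperComm 𝒜) {q : R →ₗ[ℝ] R}
    (hq : IsSuperDerivation 𝒜 1 q) {J K : Matrix (Fin n ⊕ Fin m) (Fin n ⊕ Fin m) R}
    (hJ : ∀ a b, J a b ∈ 𝒜 (parity a + parity b)) (hK : ∀ a b, K a b ∈ 𝒜 (parity a + parity b))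
    (hKJ : K * J = 1) :
    q (ber i ev J) =
      ber i ev J * ∑ b, ∑ c, ((-1 : ℤˣ) ^ (parity c)) • (K b c * q (J c b)) := by
  set A := J.toBlocks₁₁ with hA_def
  set B := J.toBlocks₁₂ with hB_def
  set C := J.toBlocks₂₁ with hC_def
  set D := J.toBlocks₂₂ with hD_def
  set K₁ := K.toBlocks₁₁ with hK₁_def
  set K₂ := K.toBlocks₁₂ with hK₂_def
  set K₃ := K.toBlocks₂₁ with hK₃_def
  set K₄ := K.toBlocks₂₂ with hK₄_def
  have hA : HasParity 𝒜 0 A := fun a b => by simpa [parity, hA_def, Matrix.toBlocks₁₁] using hJ (.inl a) (.inl b)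
  have hB : HasParity 𝒜 1 B := fun a b => by simpa [parity, hB_def, Matrix.toBlocks₁₂] using hJ (.inl a) (.inr b)
  have hC : HasParity 𝒜 1 C := fun a b => by simpa [parity, hC_def, Matrix.toBlocks₂₁] using hJ (.inr a) (.inl b)
  have hD : HasParity 𝒜 0 D := fun a b => by
    simpa [parity, hD_def, Matrix.toBlocks₂₂, (by decide : (1 + 1 : ZMod 2) = 0)] using hJ (.inr a) (.inr b)
  have hK₁ : HasParity 𝒜 0 K₁ := fun a b => by simpa [parity, hK₁_def, Matrix.toBlocks₁₁] using hK (.inl a) (.inl b)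
  have hK₃ : HasParity 𝒜 1 K₃ := fun a b => by simpa [parity, hK₃_def, Matrix.toBlocks₂₁] using hK (.inr a) (.inl b)
  have hK₄ : HasParity 𝒜 0 K₄ := fun a b => by
    simpa [parity, hK₄_def, Matrix.toBlocks₂₂, (by decide : (1 + 1 : ZMod 2) = 0)] using hK (.inr a) (.inr b)
  have hblocks : K₁ * A + K₂ * C = 1 ∧ K₁ * B + K₂ * D = 0 ∧ K₃ * A + K₄ * C = 0 ∧
      K₃ * B + K₄ * D = 1 := by
    rw [← Matrix.fromBlocks_inj, ← Matrix.fromBlocks_multiply, Matrix.fromBlocks_toBlocks,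
      Matrix.fromBlocks_toBlocks, hKJ, Matrix.fromBlocks_one]
  obtain ⟨h11, h12, h21, h22⟩ := hblocks
  -- invertibility of the odd-odd block
  have hdetD : IsUnit (D.map ev).det := by
    have hN : HasParity 𝒜 0 (K₃ * B) := by
      simpa [(by decide : (1 + 1 : ZMod 2) = 0)] using hK₃.mul hB
    -- From K₃B + K₄D = 1: the entries of K₃B are sums of products of odd elements, hence nilpotent,
    -- so K₄D and then D are invertible.
    have h1 : K₄.map ev * D.map ev = 1 - (K₃ * B).map ev := by
      refine h.matrix_ext ?_
      rw [Matrix.map_mul, h.map_map hK₄, h.map_map hD, Matrix.map_sub _ (map_sub i), h.map_map hN,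
        Matrix.map_one _ (map_zero i) (map_one i), ← h22, add_sub_cancel_left]
    have h2 : IsUnit (K₄.map ev * D.map ev).det := by
      rw [h1]
      refine isUnit_det_one_sub_of_isNilpotent _ fun a b => ?_
      have h3 : (K₃ * B).map ev a b = ∑ c, ev (K₃ a c * B c b) := by
        refine h.injective ?_
        rw [Matrix.map_apply, h.apply_ev (hN a b), Matrix.mul_apply, map_sum]
        refine Finset.sum_congr rfl fun c _ => (h.apply_ev ?_).symm
        simpa [(by decide : (1 + 1 : ZMod 2) = 0)] using SetLike.mul_mem_graded (hK₃ a c) (hB c b)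
      rw [h3]
      refine isNilpotent_sum fun c _ => ?_
      rw [← IsNilpotent.map_iff h.injective, h.apply_ev (by
        simpa [(by decide : (1 + 1 : ZMod 2) = 0)] using SetLike.mul_mem_graded (hK₃ a c) (hB c b))]
      exact isNilpotent_mul_of_odd hc (hK₃ a c) (hB c b)
    rw [Matrix.det_mul] at h2
    exact isUnit_of_mul_isUnit_right h2
  set Di := (D.map ev)⁻¹ with hDi_def
  have hDDi : D.map ev * Di = 1 := Matrix.mul_nonsing_inv _ hdetD
  have hDiD : Di * D.map ev = 1 := Matrix.nonsing_inv_mul _ hdetD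
  set D' := Di.map i with hD'_def
  have hD' : HasParity 𝒜 0 D' := h.hasParity Di
  have hDD' : D * D' = 1 := by
    rw [← h.map_map hD, hD'_def, ← Matrix.map_mul, hDDi, Matrix.map_one _ (map_zero i) (map_one i)]
  have hD'D : D' * D = 1 := by
    rw [← h.map_map hD, hD'_def, ← Matrix.map_mul, hDiD, Matrix.map_one _ (map_zero i) (map_one i)]
  set S := A - B * D' * C with hS_def
  have hS : HasParity 𝒜 0 S := by
    have h1 : HasParity 𝒜 0 (B * D' * C) := by
      simpa [(by decide : (1 + 1 : ZMod 2) = 0)] using (hB.mul hD').mul hC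
    exact fun a b => Submodule.sub_mem _ (hA a b) (h1 a b)
  have e2 : K₂ = -(K₁ * B * D') := by
    rw [← Matrix.mul_one K₂, ← hDD', ← Matrix.mul_assoc, eq_neg_of_add_eq_zero_right h12,
      Matrix.neg_mul]
  have hK₁S : K₁ * S = 1 := by
    rw [hS_def, Matrix.mul_sub, ← h11, e2, Matrix.neg_mul, ← Matrix.mul_assoc, ← Matrix.mul_assoc,
      sub_eq_add_neg]
  -- Over the commutative ring E a left inverse of a square matrix is also a right inverse; this is
  -- transported back to R.
  have hSK : S.map ev * K₁.map ev = 1 := by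
    rw [mul_eq_one_comm]
    refine h.matrix_ext ?_
    rw [Matrix.map_mul, h.map_map hK₁, h.map_map hS, hK₁S, Matrix.map_one _ (map_zero i) (map_one i)]
  have hSK₁ : S * K₁ = 1 := by
    rw [← h.map_map hS, ← h.map_map hK₁, ← Matrix.map_mul, hSK,
      Matrix.map_one _ (map_zero i) (map_one i)]
  have e3 : K₃ = -(D' * C * K₁) := by
    have h1 : K₃ * S = -(D' * C) := by
      rw [hS_def, Matrix.mul_sub, eq_neg_of_add_eq_zero_left h21, ← Matrix.mul_assoc,
        ← Matrix.mul_assoc, eq_sub_of_add_eq h22, Matrix.sub_mul, Matrix.sub_mul, Matrix.one_mul,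
        Matrix.mul_assoc K₄, hDD', Matrix.mul_one]
      abel
    rw [← Matrix.mul_one K₃, ← hSK₁, ← Matrix.mul_assoc, h1, Matrix.neg_mul]
  have e4 : K₄ = D' + D' * C * K₁ * B * D' := by
    rw [← Matrix.mul_one K₄, ← hDD', ← Matrix.mul_assoc, eq_sub_of_add_eq' h22, e3, Matrix.neg_mul,
      sub_neg_eq_add, Matrix.add_mul, Matrix.one_mul]
  have hber : ber i ev J = i ((S.map ev).det) * i Di.det := map_mul i _ _
  have d1 := h.deriv_det hc hq hSK
  have d2 := h.deriv_det hc hq hDiD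
  rw [h.map_map hS, h.map_map hK₁] at d1
  rw [h.map_map hD] at d2
  have hsum : ∑ b, ∑ c, ((-1 : ℤˣ) ^ (parity c)) • (K b c * q (J c b)) =
      (K₁ * A.map q).trace + (K₃ * B.map q).trace - (K₂ * C.map q).trace -
        (K₄ * D.map q).trace := by
    simp only [Fintype.sum_sum_type, parity, Sum.elim_inl, Sum.elim_inr, uzpow_zero, uzpow_one,
      one_smul, Units.neg_smul, Finset.sum_add_distrib, Finset.sum_neg_distrib]
    simp only [Matrix.trace, Matrix.diag_apply, Matrix.mul_apply, Matrix.map_apply]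
    simp only [hA_def, hB_def, hC_def, hD_def, hK₁_def, hK₂_def, hK₃_def, hK₄_def,
      Matrix.toBlocks₁₁, Matrix.toBlocks₁₂, Matrix.toBlocks₂₁, Matrix.toBlocks₂₂, Matrix.of_apply]
    abel
  have key := trace_blocks hc hq (A := A) hB hC hD' hK₁ hDD' hD'D hD
  rw [← e2, ← e3, ← e4] at key
  rw [hsum, ← key, hber, hq.leibniz_zero _ (h.mem _), d1, d2, mul_add, mul_assoc,
    mul_assoc (i (S.map ev).det), mul_assoc (i (S.map ev).det)]
  congr 2
  refine ((hc.commute (h.mem Di.det) (j := 1) ?_).eq).symm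
  exact Submodule.sum_mem _ fun a _ => by simpa using hK₁.mul (hS.map hq) a a

end Berezinian

/-! ### Coordinate systems -/

section Coordinates

variable {R : Type*} [Ring R] [Algebra ℝ R] {n m : ℕ}

/-- A system of coordinates `x` with partial derivatives `∂`. -/
structure IsCoordSystem (𝒜 : ZMod 2 → Submodule ℝ R) (x : Fin n ⊕ Fin m → R)
    (pd : Fin n ⊕ Fin m → R →ₗ[ℝ] R) : Prop where
  mem : ∀ a, x a ∈ 𝒜 (parity a)
  isSuperDerivation : ∀ a, IsSuperDerivation 𝒜 (parity a) (pd a)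
  pd_coord : ∀ a b, pd a (x b) = if a = b then 1 else 0
  pd_comm : ∀ a b f, pd a (pd b f) = ((-1 : ℤˣ) ^ (parity a * parity b)) • pd b (pd a f)
  chain : ∀ {p : ZMod 2} {D : R →ₗ[ℝ] R}, IsSuperDerivation 𝒜 p D →
    ∀ f, D f = ∑ a, D (x a) * pd a f

/-- The divergence of a vector field with respect to coordinates. -/
def coordDiv (x : Fin n ⊕ Fin m → R) (pd : Fin n ⊕ Fin m → R →ₗ[ℝ] R) (q : R →ₗ[ℝ] R) : R :=
  ∑ a, pd a (q (x a))

namespace IsCoordSystem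

variable {𝒜 : ZMod 2 → Submodule ℝ R} {x x' : Fin n ⊕ Fin m → R}
  {pd pd' : Fin n ⊕ Fin m → R →ₗ[ℝ] R} (h : IsCoordSystem 𝒜 x pd) (h' : IsCoordSystem 𝒜 x' pd')
include h

theorem sum_pd_mul {q : R →ₗ[ℝ] R} (hq : IsSuperDerivation 𝒜 1 q) (s : R) :
    ∑ a, pd a (q (x a) * s) = coordDiv x pd q * s + q s := by
  rw [coordDiv, Finset.sum_mul, h.chain hq s, ← Finset.sum_add_distrib]
  refine Finset.sum_congr rfl fun a _ => ?_
  rw [(h.isSuperDerivation a).leibniz _ (hq.mem (h.mem a))]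
  -- Q^a has parity |a| + 1, so the Leibniz sign (-1)^{|a|(|a|+1)} is trivial.
  have h0 : ∀ p : ZMod 2, p * (p + 1) = 0 := by decide
  rw [h0, uzpow_zero, one_smul]

theorem coordDiv_mem {q : R →ₗ[ℝ] R} (hq : IsSuperDerivation 𝒜 1 q) : coordDiv x pd q ∈ 𝒜 1 := by
  refine Submodule.sum_mem _ fun a _ => ?_
  have := (h.isSuperDerivation a).mem (hq.mem (h.mem a))
  have h0 : ∀ p : ZMod 2, p + 1 + p = 1 := by decide
  rwa [h0] at this

/-- Apply ∂_b to Q²(x^b) = 0 and sum with signs: Q of the divergence is minus the supertrace of X²,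
where X = (∂_b Q^a). That supertrace changes sign when the summation indices are exchanged, X being
an odd supermatrix. -/
theorem map_coordDiv (hc : IsSuperComm 𝒜) {q : R →ₗ[ℝ] R} (hq : IsSuperDerivation 𝒜 1 q)
    (hqq : ∀ f, q (q f) = 0) : q (coordDiv x pd q) = 0 := by
  set X : Fin n ⊕ Fin m → Fin n ⊕ Fin m → R := fun b a => pd b (q (x a)) with hX
  have hXm (b a) : X b a ∈ 𝒜 (parity a + 1 + parity b) :=
    (h.isSuperDerivation b).mem (hq.mem (h.mem a))
  have h1 (b : Fin n ⊕ Fin m) : ∑ a, X b a * X a b +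
      ((-1 : ℤˣ) ^ parity b) • ∑ a, q (x a) * pd a (X b b) = 0 := by
    -- The chain rule identifies the sum with Q(Q(x^b)).
    have h2 : pd b (∑ a, q (x a) * pd a (q (x b))) = 0 := by
      rw [← h.chain hq, hqq, map_zero]
    rw [← h2, map_sum, Finset.smul_sum, ← Finset.sum_add_distrib]
    refine Finset.sum_congr rfl fun a _ => ?_
    rw [(h.isSuperDerivation b).leibniz _ (hq.mem (h.mem a)), h.pd_comm b a, mul_smul_comm, smul_smul,
      ← uzpow_add]
    congr 3
    generalize parity a = s
    generalize parity b = t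
    revert s t
    decide
  have h3 : q (coordDiv x pd q) = -∑ b, ∑ a, ((-1 : ℤˣ) ^ parity b) • (X b a * X a b) := by
    rw [coordDiv, map_sum, ← Finset.sum_neg_distrib]
    refine Finset.sum_congr rfl fun b _ => ?_
    rw [h.chain hq, ← Finset.smul_sum, eq_neg_of_add_eq_zero_left (h1 b), smul_neg, smul_smul,
      ← uzpow_add, (by decide : ∀ t : ZMod 2, t + t = 0), uzpow_zero, one_smul, neg_neg]
  have h4 : ∑ b, ∑ a, ((-1 : ℤˣ) ^ parity b) • (X b a * X a b) =
      -∑ b, ∑ a, ((-1 : ℤˣ) ^ parity b) • (X b a * X a b) := by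
    conv_lhs => rw [Finset.sum_comm]
    rw [← Finset.sum_neg_distrib]
    refine Finset.sum_congr rfl fun a _ => ?_
    rw [← Finset.sum_neg_distrib]
    refine Finset.sum_congr rfl fun b _ => ?_
    have h0 : (-1 : ℤˣ) ^ (parity b + (parity a + 1 + parity b) * (parity b + 1 + parity a)) =
        -(-1) ^ parity a := by
      generalize parity a = s
      generalize parity b = t
      revert s t
      decide
    rw [hc _ _ _ _ (hXm b a) (hXm a b), smul_smul, ← uzpow_add, h0, Units.neg_smul]
  have h5 : (2 : ℝ) • ∑ b, ∑ a, ((-1 : ℤˣ) ^ parity b) • (X b a * X a b) = 0 := by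
    rw [two_smul]
    nth_rewrite 1 [h4]
    exact neg_add_cancel _
  rw [h3, (smul_eq_zero.1 h5).resolve_left two_ne_zero, neg_zero]

include h'

theorem sum_jacobian_mul (a c : Fin n ⊕ Fin m) :
    ∑ b, pd a (x' b) * pd' b (x c) = if a = c then 1 else 0 := by
  rw [← h'.chain (h.isSuperDerivation a), h.pd_coord]

theorem jacobian_mem (a b : Fin n ⊕ Fin m) : pd a (x' b) ∈ 𝒜 (parity a + parity b) := by
  rw [add_comm]
  exact (h.isSuperDerivation a).mem (h'.mem b)

/-- Expand ∂'_b and Q(x'^b) in the coordinates x and use the Leibniz rule. The terms with ∂_c Q^a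
contract with the product of the two Jacobians to the old divergence; the others, with second
derivatives of x'^b, assemble to Q of the Jacobian. -/
theorem coordDiv_eq [SetLike.GradedMonoid 𝒜] (hc : IsSuperComm 𝒜) {q : R →ₗ[ℝ] R} (hq : IsSuperDerivation 𝒜 1 q) :
    coordDiv x' pd' q = coordDiv x pd q +
      ∑ b, ∑ c, ((-1 : ℤˣ) ^ (parity c)) • (pd' b (x c) * q (pd c (x' b))) := by
  have h1 (b : Fin n ⊕ Fin m) : pd' b (q (x' b)) =
      ∑ c, ∑ a, pd' b (x c) * (pd c (q (x a)) * pd a (x' b)) +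
        ∑ c, ((-1 : ℤˣ) ^ (parity c)) • (pd' b (x c) * q (pd c (x' b))) := by
    rw [h.chain (h'.isSuperDerivation b), h.chain hq (x' b), ← Finset.sum_add_distrib]
    refine Finset.sum_congr rfl fun c _ => ?_
    rw [map_sum, h.chain hq (pd c (x' b)), ← mul_smul_comm, ← Finset.mul_sum, ← mul_add,
      Finset.smul_sum, ← Finset.sum_add_distrib]
    congr 1
    refine Finset.sum_congr rfl fun a _ => ?_
    rw [(h.isSuperDerivation c).leibniz _ (hq.mem (h.mem a)), h.pd_comm c a, mul_smul_comm, smul_smul,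
      ← uzpow_add]
    congr 3
    generalize parity a = s
    generalize parity c = t
    revert s t
    decide
  rw [coordDiv, Finset.sum_congr rfl fun b _ => h1 b, Finset.sum_add_distrib]
  congr 1
  have h2 (a b c : Fin n ⊕ Fin m) : pd' b (x c) * (pd c (q (x a)) * pd a (x' b)) =
      pd a (x' b) * pd' b (x c) * pd c (q (x a)) := by
    rw [← mul_assoc, mul_assoc (pd a (x' b)), hc _ _ _ _ (h.jacobian_mem h' a b)
      (SetLike.mul_mem_graded (h'.jacobian_mem h b c)
        ((h.isSuperDerivation c).mem (hq.mem (h.mem a))))]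
    -- The two exchanged factors have parities s = |a| + |b| and s + 1, so no sign appears.
    have h0 : (parity a + parity b) * (parity b + parity c + (parity a + 1 + parity c)) = 0 := by
      generalize parity a = s
      generalize parity b = t
      generalize parity c = r
      revert s t r
      decide
    rw [h0, uzpow_zero, one_smul]
  simp only [h2]
  rw [Finset.sum_comm]
  rw [coordDiv]
  have h3 (c : Fin n ⊕ Fin m) : ∑ b, ∑ a, pd a (x' b) * pd' b (x c) * pd c (q (x a)) =
      pd c (q (x c)) := by
    rw [Finset.sum_comm]
    simp only [← Finset.sum_mul, h.sum_jacobian_mul h']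
    simp
  exact Finset.sum_congr rfl fun c _ => h3 c

end IsCoordSystem

end Coordinates

/-! ### Transport along isomorphisms -/

section Transport

variable {R R' : Type*} [Ring R] [Algebra ℝ R] [Ring R'] [Algebra ℝ R']
  {𝒜 : ZMod 2 → Submodule ℝ R} {ℬ : ZMod 2 → Submodule ℝ R'}

theorem IsSuperDerivation.conj (e : R ≃ₐ[ℝ] R') (he : ∀ i f, f ∈ 𝒜 i ↔ e f ∈ ℬ i) {p : ZMod 2}
    {D : R' →ₗ[ℝ] R'} (hD : IsSuperDerivation ℬ p D) :
    IsSuperDerivation 𝒜 p (e.symm.toLinearMap ∘ₗ D ∘ₗ e.toLinearMap) where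
  mem {i f} hf := by
    rw [he]
    simpa using hD.mem ((he i f).1 hf)
  leibniz {i f} g hf := by
    have h := hD.leibniz (e g) ((he i f).1 hf)
    simp only [LinearMap.comp_apply, AlgEquiv.toLinearMap_apply, map_mul, h, map_add]
    rw [e.symm_apply_apply, Units.smul_def, map_zsmul, map_mul, e.symm_apply_apply,
      Units.smul_def]

theorem IsCoordSystem.conj {n m : ℕ} (e : R ≃ₐ[ℝ] R') (he : ∀ i f, f ∈ 𝒜 i ↔ e f ∈ ℬ i)
    {x : Fin n ⊕ Fin m → R'} {pd : Fin n ⊕ Fin m → R' →ₗ[ℝ] R'} (h : IsCoordSystem ℬ x pd) :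
    IsCoordSystem 𝒜 (fun a => e.symm (x a))
      (fun a => e.symm.toLinearMap ∘ₗ pd a ∘ₗ e.toLinearMap) where
  mem a := by rw [he, e.apply_symm_apply]; exact h.mem a
  isSuperDerivation a := (h.isSuperDerivation a).conj e he
  pd_coord a b := by
    simp only [LinearMap.comp_apply, AlgEquiv.toLinearMap_apply, e.apply_symm_apply, h.pd_coord]
    split_ifs <;> simp
  pd_comm a b f := by
    simp only [LinearMap.comp_apply, AlgEquiv.toLinearMap_apply, e.apply_symm_apply]
    rw [h.pd_comm, Units.smul_def, map_zsmul, Units.smul_def]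
  chain {p D} hD f := by
    have he' : ∀ i f, f ∈ ℬ i ↔ e.symm f ∈ 𝒜 i := fun i f => by rw [he, e.apply_symm_apply]
    have h1 := h.chain (hD.conj e.symm he') (e f)
    simp only [LinearMap.comp_apply, AlgEquiv.toLinearMap_apply, e.symm_symm, e.symm_apply_apply]
      at h1 ⊢
    rw [← e.symm_apply_apply (D f), h1, map_sum]
    simp

end Transport

theorem Model.isCoordSystem {n m : ℕ} (V : Opens (Euc n)) :
    IsCoordSystem (Model.grading (m := m) V) (Model.coord V) (Model.pd V) where
  mem := Model.coord_mem
  isSuperDerivation := Model.isSuperDerivation_pd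
  pd_coord := Model.pd_coord
  pd_comm := Model.pd_comm
  chain hD := Model.derivation_eq_sum hD

theorem VectorField.isSuperDerivation {M : SuperSpace.{u}} {p : ZMod 2} (X : VectorField M p)
    (U : Opens M.space) : IsSuperDerivation (M.grading U) p (X.app U) where
  mem hf := X.app_mem U _ _ hf
  leibniz g hf := X.leibniz U _ _ g hf

/-! ### Restriction, gluing and parity of sections -/

namespace SuperSpace

variable (M : SuperSpace.{u}) {U V W : Opens M.space}

theorem isSuperComm (U : Opens M.space) : IsSuperComm (M.grading U) := M.supercomm U

/-- The inclusion of the even sections, as a ring homomorphism. -/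
def evenIncl (U : Opens M.space) : M.evenPart U →+* M.Fn U where
  toFun := Subtype.val
  map_one' := rfl
  map_mul' _ _ := rfl
  map_zero' := rfl
  map_add' _ _ := rfl

theorem isEvenPart (U : Opens M.space) :
    IsEvenPart (M.grading U) (M.evenIncl U) M.evenComponent where
  injective := Subtype.val_injective
  mem e := e.2
  apply_ev hf := DirectSum.decompose_of_mem_same _ hf

theorem berezinian_mem {n m : ℕ} (J : Matrix (Fin n ⊕ Fin m) (Fin n ⊕ Fin m) (M.Fn U)) :
    M.berezinian J ∈ M.grading U 0 := Subtype.property _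

variable {M}

theorem res_res (h : V ≤ U) (h' : W ≤ V) (f : M.Fn U) :
    M.res h' (M.res h f) = M.res (h'.trans h) f := by
  have := M.sheaf.obj.map_comp (homOfLE h).op (homOfLE h').op
  exact (congrArg (fun g => g.hom f) this).symm

theorem res_mem (h : V ≤ U) {i : ZMod 2} {f : M.Fn U} (hf : f ∈ M.grading U i) :
    M.res h f ∈ M.grading V i := M.map_mem h i f hf

/-- Sections that agree on a cover are equal. -/
theorem eq_of_res_eq {ι : Type u} (D : ι → Opens M.space) (hD : ∀ i, D i ≤ U) (hcov : U ≤ iSup D)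
    {f g : M.Fn U} (h : ∀ i, M.res (hD i) f = M.res (hD i) g) : f = g :=
  M.sheaf.eq_of_locally_eq' D U (fun i => homOfLE (hD i)) hcov f g h

theorem exists_glue {ι : Type u} (D : ι → Opens M.space) (hD : ∀ i, D i ≤ U) (hcov : U ≤ iSup D)
    (f : ∀ i, M.Fn (D i)) (h : ∀ i j, M.res (inf_le_left : D i ⊓ D j ≤ D i) (f i) =
      M.res (inf_le_right : D i ⊓ D j ≤ D j) (f j)) :
    ∃ g : M.Fn U, ∀ i, M.res (hD i) g = f i :=
  (M.sheaf.existsUnique_gluing' D U (fun i => homOfLE (hD i)) hcov f h).exists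

/-- Homogeneous components commute with restriction, so parity is a local property. -/
theorem mem_of_res_mem {ι : Type u} (D : ι → Opens M.space) (hD : ∀ i, D i ≤ U) (hcov : U ≤ iSup D)
    {f : M.Fn U} {k : ZMod 2} (h : ∀ i, M.res (hD i) f ∈ M.grading (D i) k) :
    f ∈ M.grading U k := by
  have key (i : ι) (l : ZMod 2) : M.res (hD i) (DirectSum.decompose (M.grading U) f l : M.Fn U) =
      DirectSum.decompose (M.grading (D i)) (M.res (hD i) f) l := by
    generalize f = f
    induction f using DirectSum.Decomposition.inductionOn (M.grading U) with
    | zero => simp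
    | @homogeneous j f =>
      rcases eq_or_ne j l with rfl | hjl
      · rw [DirectSum.decompose_of_mem_same _ f.2,
          DirectSum.decompose_of_mem_same _ (res_mem (hD i) f.2)]
      · rw [DirectSum.decompose_of_mem_ne _ f.2 hjl,
          DirectSum.decompose_of_mem_ne _ (res_mem (hD i) f.2) hjl, map_zero]
    | add f g hf hg => simp [DirectSum.decompose_add, hf, hg]
  have h1 : (DirectSum.decompose (M.grading U) f k : M.Fn U) = f := by
    refine eq_of_res_eq D hD hcov fun i => ?_
    rw [key, DirectSum.decompose_of_mem_same _ (h i)]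
  rw [← h1]
  exact SetLike.coe_mem _

/-! ### Coordinates and point values in charts -/

namespace Chart

variable {n m : ℕ} (φ ψ : M.Chart n m)

theorem isCoordSystem (hW : W ≤ φ.dom) :
    IsCoordSystem (M.grading W) (φ.coord W hW) (φ.pd W hW) :=
  (Model.isCoordSystem _).conj (φ.iso W hW) (φ.iso_mem W hW)

theorem res_coord (hW : W ≤ φ.dom) (h : V ≤ W) (a : Fin n ⊕ Fin m) :
    M.res h (φ.coord W hW a) = φ.coord V (h.trans hW) a := by
  refine (φ.iso V (h.trans hW)).injective ?_
  rw [φ.iso_res W V hW h]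
  simp only [coord, AlgEquiv.apply_symm_apply]
  exact Model.res_coord _ a

theorem res_pd (hW : W ≤ φ.dom) (h : V ≤ W) (a : Fin n ⊕ Fin m) (f : M.Fn W) :
    M.res h (φ.pd W hW a f) = φ.pd V (h.trans hW) a (M.res h f) := by
  refine (φ.iso V (h.trans hW)).injective ?_
  rw [φ.iso_res W V hW h]
  simp only [pd, LinearMap.comp_apply, AlgEquiv.toLinearMap_apply, AlgEquiv.apply_symm_apply]
  rw [φ.iso_res W V hW h]
  exact (Model.pd_res _ a _).symm

/-- The value of a section at a point, computed in a chart. -/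
noncomputable def val (hW : W ≤ φ.dom) (f : M.Fn W) (x : W) : ℝ :=
  Model.body _ (φ.iso W hW f) ⟨φ.toHomeo x, Set.mem_image_of_mem _ x.2⟩

theorem val_res (hW : W ≤ φ.dom) (h : V ≤ W) (f : M.Fn W) (x : V) :
    φ.val (h.trans hW) (M.res h f) x = φ.val hW f ⟨x, h x.2⟩ := by
  rw [val, φ.iso_res W V hW h]
  exact DFunLike.congr_fun (Model.body_res _ (φ.iso W hW f)) _

theorem continuous_val (hW : W ≤ φ.dom) (f : M.Fn W) : Continuous (φ.val hW f) := by
  refine (Model.body _ (φ.iso W hW f)).contMDiff.continuous.comp (Continuous.subtype_mk ?_ _)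
  exact (φ.toHomeo.continuousOn.mono hW).domRestrict

theorem isUnit_of_val_ne_zero (hW : W ≤ φ.dom) {f : M.Fn W} (hf : ∀ x, φ.val hW f x ≠ 0) :
    IsUnit f := by
  rw [← MulEquiv.isUnit_map (φ.iso W hW)]
  refine Model.isUnit_of_body_ne_zero ?_
  rintro ⟨_, x, hx, rfl⟩
  exact hf ⟨x, hx⟩

theorem val_ne_zero_of_isUnit (hW : W ≤ φ.dom) {f : M.Fn W} (hf : IsUnit f) (x : W) :
    φ.val hW f x ≠ 0 :=
  (((hf.map (φ.iso W hW)).map (Model.body _)).map (Smooth.eval _)).ne_zero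

theorem val_sub_algebraMap (hW : W ≤ φ.dom) (f : M.Fn W) (c : ℝ) (x : W) :
    φ.val hW (f - algebraMap ℝ _ c) x = φ.val hW f x - c := by
  rw [val, map_sub, map_sub, AlgEquiv.commutes, AlgHom.commutes]
  rfl

/-- The value of a section at a point does not depend on the chart. -/
theorem val_eq_val (hφ : W ≤ φ.dom) (hψ : W ≤ ψ.dom) (f : M.Fn W) (x : W) :
    φ.val hφ f x = ψ.val hψ f x := by
  by_contra hne
  -- The value of f at x is characterised by invertibility: if the two charts disagreed, g would
  -- have nonzero ψ-values near x, hence be a unit there, while its φ-value at x is 0.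
  set g := f - algebraMap ℝ (M.Fn W) (φ.val hφ f x) with hg
  have h1 : φ.val hφ g x = 0 := by rw [hg, val_sub_algebraMap, sub_self]
  have h2 : ψ.val hψ g x ≠ 0 := by
    rw [hg, val_sub_algebraMap, sub_ne_zero]
    exact fun h => hne h.symm
  let W' : Opens M.space := ⟨Subtype.val '' {y : W | ψ.val hψ g y ≠ 0},
    W.isOpen.isOpenMap_subtype_val _ (isOpen_ne.preimage (ψ.continuous_val hψ g))⟩
  have hW' : W' ≤ W := by rintro _ ⟨y, -, rfl⟩; exact y.2
  have h3 : IsUnit (M.res hW' g) := by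
    refine ψ.isUnit_of_val_ne_zero (hW'.trans hψ) fun y => ?_
    rw [ψ.val_res hψ hW']
    obtain ⟨z, hz, hzy⟩ := y.2
    have : (⟨y, hW' y.2⟩ : W) = z := Subtype.ext hzy.symm
    rw [this]
    exact hz
  have h4 := φ.val_ne_zero_of_isUnit (hW'.trans hφ) h3 ⟨x, x, h2, rfl⟩
  rw [φ.val_res hφ hW'] at h4
  exact h4 h1

/-- A section is determined by its values and its odd partial derivatives. -/
theorem ext_val_pd (hW : W ≤ φ.dom) {f g : M.Fn W} (hv : ∀ x, φ.val hW f x = φ.val hW g x)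
    (hpd : ∀ i, φ.pd W hW (.inr i) f = φ.pd W hW (.inr i) g) : f = g := by
  refine (φ.iso W hW).injective (Model.ext_body_pd ?_ fun i => ?_)
  · ext ⟨_, x, hx, rfl⟩
    exact hv ⟨x, hx⟩
  · exact (φ.iso W hW).symm.injective (hpd i)

end Chart

end SuperSpace

/-! ### Parity of quotients and differential identities checked on coordinates -/

section Graded

variable {R : Type*} [Ring R] [Algebra ℝ R] {𝒜 : ZMod 2 → Submodule ℝ R}

/-- Multiplication by the even element a commutes with taking the component of degree k, and a can
be cancelled. -/
theorem mem_of_mul_mem [GradedAlgebra 𝒜] {a f : R} {k : ZMod 2} (ha : a ∈ 𝒜 0) (hu : IsUnit a)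
    (haf : a * f ∈ 𝒜 k) : f ∈ 𝒜 k := by
  have h1 : (DirectSum.decompose 𝒜 f k : R) = f := by
    refine hu.mul_left_cancel ?_
    rw [← DirectSum.coe_decompose_mul_of_left_mem_zero 𝒜 ha, DirectSum.decompose_of_mem_same 𝒜 haf]
  rw [← h1]
  exact SetLike.coe_mem _

theorem IsCoordSystem.derivation_mul_eq {n m : ℕ} {x : Fin n ⊕ Fin m → R}
    {pd : Fin n ⊕ Fin m → R →ₗ[ℝ] R} (h : IsCoordSystem 𝒜 x pd) {f k f' : R}
    (hf : ∀ a, pd a f * k = pd a f') {p : ZMod 2} {D : R →ₗ[ℝ] R} (hD : IsSuperDerivation 𝒜 p D) :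
    D f * k = D f' := by
  rw [h.chain hD, h.chain hD f', Finset.sum_mul]
  exact Finset.sum_congr rfl fun a _ => by rw [mul_assoc, hf]

end Graded

namespace SuperSpace.Chart

variable {M : SuperSpace.{u}} {V W : Opens M.space} {n m : ℕ} (φ ψ : M.Chart n m)

theorem val_mul (hW : W ≤ φ.dom) (f g : M.Fn W) (x : W) :
    φ.val hW (f * g) x = φ.val hW f x * φ.val hW g x := by
  rw [val, map_mul, map_mul]
  rfl

theorem val_one (hW : W ≤ φ.dom) (x : W) : φ.val hW 1 x = 1 := by
  rw [val, map_one, map_one]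
  rfl

/-- A derivation of 𝒪(W) need not come from the domain of φ, for instance a coordinate derivative of
another chart. The identity is restricted for the coordinate derivatives of φ and extended by the
chain rule. -/
theorem res_derivation_mul_eq {f k f' : M.Fn φ.dom}
    (hf : ∀ (p : ZMod 2) (D : M.Fn φ.dom →ₗ[ℝ] M.Fn φ.dom), IsSuperDerivation (M.grading φ.dom) p D →
      D f * k = D f')
    (hW : W ≤ φ.dom) {p : ZMod 2} {D : M.Fn W →ₗ[ℝ] M.Fn W}
    (hD : IsSuperDerivation (M.grading W) p D) :
    D (M.res hW f) * M.res hW k = D (M.res hW f') := by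
  refine (φ.isCoordSystem hW).derivation_mul_eq (fun a => ?_) hD
  rw [← φ.res_pd le_rfl hW, ← φ.res_pd le_rfl hW, ← map_mul,
    hf _ _ ((φ.isCoordSystem le_rfl).isSuperDerivation a)]

/-- Two solutions `u`, `v` of `D u = D g * u` with the same values agree. -/
theorem eq_of_logDeriv_eq (hW : W ≤ φ.dom) {g u v : M.Fn W} (hv0 : v ∈ M.grading W 0)
    (hv : IsUnit v)
    (hu : ∀ i, φ.pd W hW (.inr i) g * u = φ.pd W hW (.inr i) u)
    (hv' : ∀ i, φ.pd W hW (.inr i) g * v = φ.pd W hW (.inr i) v)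
    (hval : ∀ x, φ.val hW u x = φ.val hW v x) : u = v := by
  -- Write u = vs. The two equations leave v D(s) = 0 for the odd derivatives, and s has value 1
  -- everywhere, so s = 1.
  obtain ⟨s, rfl⟩ := hv.dvd (a := u)
  suffices s = 1 by rw [this, mul_one]
  refine φ.ext_val_pd hW (fun x => ?_) fun i => ?_
  · have h1 := hval x
    rw [val_mul] at h1
    rw [val_one]
    exact mul_left_cancel₀ (φ.val_ne_zero_of_isUnit hW hv x) (h1.trans (mul_one _).symm)
  · have hD := (φ.isCoordSystem hW).isSuperDerivation (.inr i)
    have h1 := hu i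
    rw [hD.leibniz_zero _ hv0, ← hv', mul_assoc, left_eq_add] at h1
    rw [hD.map_one (SetLike.one_mem_graded (M.grading W))]
    exact hv.mul_right_eq_zero.1 h1

end SuperSpace.Chart

namespace Supermanifold

variable {n m : ℕ} {M : Supermanifold.{u} n m}

theorem top_le_iSup_dom : (⊤ : Opens M.space) ≤ ⨆ φ : M.toSuperSpace.Chart n m, φ.dom :=
  fun p _ => by
    obtain ⟨φ, hφ⟩ := M.exists_chart p
    exact Opens.mem_iSup.2 ⟨φ, hφ⟩

theorem eq_of_res_dom_eq {f g : M.Fn ⊤}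
    (h : ∀ φ : M.toSuperSpace.Chart n m, M.res (le_top : φ.dom ≤ ⊤) f = M.res le_top g) : f = g :=
  SuperSpace.eq_of_res_eq (M := M.toSuperSpace) (fun φ : M.toSuperSpace.Chart n m => φ.dom)
    (fun _ => le_top) top_le_iSup_dom h

theorem exists_glue_dom (f : ∀ φ : M.toSuperSpace.Chart n m, M.Fn φ.dom)
    (h : ∀ φ ψ : M.toSuperSpace.Chart n m, M.res (inf_le_left : φ.dom ⊓ ψ.dom ≤ φ.dom) (f φ) =
      M.res (inf_le_right : φ.dom ⊓ ψ.dom ≤ ψ.dom) (f ψ)) :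
    ∃ g : M.Fn ⊤, ∀ φ : M.toSuperSpace.Chart n m, M.res (le_top : φ.dom ≤ ⊤) g = f φ :=
  SuperSpace.exists_glue (M := M.toSuperSpace) (fun φ : M.toSuperSpace.Chart n m => φ.dom)
    (fun _ => le_top) top_le_iSup_dom f h

theorem mem_of_res_dom_mem {f : M.Fn ⊤} {k : ZMod 2}
    (h : ∀ φ : M.toSuperSpace.Chart n m, M.res (le_top : φ.dom ≤ ⊤) f ∈ M.grading φ.dom k) :
    f ∈ M.grading ⊤ k :=
  SuperSpace.mem_of_res_mem (M := M.toSuperSpace) (fun φ : M.toSuperSpace.Chart n m => φ.dom)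
    (fun _ => le_top) top_le_iSup_dom h

/-! ### Exponential and logarithm -/

/-- The chart formula for exp enters the gluing only through these properties, which make no
reference to coordinates apart from point values. -/
theorem exp_local (φ : M.toSuperSpace.Chart n m) {g h : M.Fn φ.dom} (hg : g ∈ M.grading φ.dom 0)
    (hh : φ.iso φ.dom le_rfl h = Model.exp (φ.iso φ.dom le_rfl g)) :
    h ∈ M.grading φ.dom 0 ∧ IsUnit h ∧
      (∀ x, φ.val le_rfl h x = Real.exp (φ.val le_rfl g x)) ∧
      ∀ (p : ZMod 2) (D : M.Fn φ.dom →ₗ[ℝ] M.Fn φ.dom), IsSuperDerivation (M.grading φ.dom) p D →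
        D g * h = D h := by
  have hg' := (φ.iso_mem φ.dom le_rfl 0 g).1 hg
  refine ⟨?_, ?_, fun x => ?_, fun p D hD => ?_⟩
  · rw [φ.iso_mem φ.dom le_rfl, hh]
    exact Model.exp_mem hg'
  · rw [← MulEquiv.isUnit_map (φ.iso φ.dom le_rfl), hh]
    exact Model.isUnit_exp _
  · rw [SuperSpace.Chart.val, hh, Model.body_exp]
    rfl
  · have he : ∀ i f, f ∈ Model.grading _ i ↔ (φ.iso φ.dom le_rfl).symm f ∈ M.grading φ.dom i :=
      fun i f => by rw [φ.iso_mem φ.dom le_rfl, AlgEquiv.apply_symm_apply]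
    have h1 := Model.derivation_exp (hD.conj (φ.iso φ.dom le_rfl).symm he) hg'
    rw [← hh] at h1
    simp only [LinearMap.comp_apply, AlgEquiv.toLinearMap_apply, AlgEquiv.symm_symm,
      AlgEquiv.symm_apply_apply, ← map_mul] at h1
    exact ((φ.iso φ.dom le_rfl).injective h1).symm

/-- On an overlap the two chart formulas solve the same equation D u = D(g) u with the same values,
so they agree and glue. Uniqueness holds since the formula fixes the function in every chart. -/
theorem existsUnique_exp {g : M.Fn ⊤} (hg : g ∈ M.grading ⊤ 0) : ∃! h : M.Fn ⊤, IsExp g h := by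
  have hgφ (φ : M.toSuperSpace.Chart n m) : M.res (le_top : φ.dom ≤ ⊤) g ∈ M.grading φ.dom 0 :=
    SuperSpace.res_mem _ hg
  obtain ⟨h, hh⟩ := exists_glue_dom (M := M) (fun φ => (φ.iso φ.dom le_rfl).symm
    (Model.exp (φ.iso φ.dom le_rfl (M.res le_top g)))) (by
    intro φ ψ
    obtain ⟨a0, au, av, aD⟩ := exp_local φ (hgφ φ) (AlgEquiv.apply_symm_apply (φ.iso φ.dom le_rfl) _)
    obtain ⟨b0, bu, bv, bD⟩ := exp_local ψ (hgφ ψ) (AlgEquiv.apply_symm_apply (ψ.iso ψ.dom le_rfl) _)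
    have hl : M.res (inf_le_left : φ.dom ⊓ ψ.dom ≤ φ.dom) (M.res le_top g) = M.res le_top g :=
      SuperSpace.res_res _ _ _
    have hr : M.res (inf_le_right : φ.dom ⊓ ψ.dom ≤ ψ.dom) (M.res le_top g) = M.res le_top g :=
      SuperSpace.res_res _ _ _
    refine φ.eq_of_logDeriv_eq inf_le_left (g := M.res le_top g) (SuperSpace.res_mem _ b0)
      (bu.map (M.res inf_le_right)) (fun i => ?_) (fun i => ?_) fun x => ?_
    · have := φ.res_derivation_mul_eq aD inf_le_left
        ((φ.isCoordSystem (inf_le_left : φ.dom ⊓ ψ.dom ≤ φ.dom)).isSuperDerivation (.inr i))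
      rwa [hl] at this
    · have := ψ.res_derivation_mul_eq bD inf_le_right
        ((φ.isCoordSystem (inf_le_left : φ.dom ⊓ ψ.dom ≤ φ.dom)).isSuperDerivation (.inr i))
      rwa [hr] at this
    · rw [φ.val_eq_val ψ inf_le_left inf_le_right (M.res inf_le_right _),
        φ.val_res le_rfl inf_le_left, ψ.val_res le_rfl inf_le_right, av, bv,
        ← φ.val_res le_rfl inf_le_left, ← ψ.val_res le_rfl inf_le_right, hl, hr,
        φ.val_eq_val ψ inf_le_left inf_le_right])
  refine ⟨h, fun φ => ?_, fun h' hh' => eq_of_res_dom_eq fun φ => ?_⟩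
  · rw [hh, AlgEquiv.apply_symm_apply]
  · rw [hh, ← hh' φ, AlgEquiv.symm_apply_apply]

theorem log_local (φ : M.toSuperSpace.Chart n m) {h : M.Fn φ.dom} (hh : h ∈ M.grading φ.dom 0)
    (hu : IsUnit h) :
    ∃ g ∈ M.grading φ.dom 0, (∀ x, φ.val le_rfl g x = Real.log (φ.val le_rfl h x)) ∧
      ∀ (p : ZMod 2) (D : M.Fn φ.dom →ₗ[ℝ] M.Fn φ.dom), IsSuperDerivation (M.grading φ.dom) p D →
        D g * h = D h := by
  obtain ⟨g, hg, hv, hD⟩ := Model.exists_log ((φ.iso_mem φ.dom le_rfl 0 h).1 hh) (by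
    rintro ⟨_, x, hx, rfl⟩
    exact φ.val_ne_zero_of_isUnit le_rfl hu ⟨x, hx⟩)
  refine ⟨(φ.iso φ.dom le_rfl).symm g, ?_, fun x => ?_, fun p D hD' => ?_⟩
  · rwa [φ.iso_mem φ.dom le_rfl, AlgEquiv.apply_symm_apply]
  · rw [SuperSpace.Chart.val, AlgEquiv.apply_symm_apply, hv]
    rfl
  · have he : ∀ i f, f ∈ Model.grading _ i ↔ (φ.iso φ.dom le_rfl).symm f ∈ M.grading φ.dom i :=
      fun i f => by rw [φ.iso_mem φ.dom le_rfl, AlgEquiv.apply_symm_apply]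
    have h1 := hD p _ (hD'.conj (φ.iso φ.dom le_rfl).symm he)
    simp only [LinearMap.comp_apply, AlgEquiv.toLinearMap_apply, AlgEquiv.symm_symm,
      AlgEquiv.symm_apply_apply, ← map_mul] at h1
    exact (φ.iso φ.dom le_rfl).injective h1

/-- The local logarithms log|h| have equal values on overlaps, and their odd derivatives agree
because each, multiplied by the invertible h, gives the derivative of h. -/
theorem exists_log {h : M.Fn ⊤} (hh : h ∈ M.grading ⊤ 0)
    (hu : ∀ φ : M.toSuperSpace.Chart n m, IsUnit (M.res (le_top : φ.dom ≤ ⊤) h)) :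
    ∃ g ∈ M.grading ⊤ 0, ∀ {p : ZMod 2} (X : VectorField M.toSuperSpace p),
      X.app ⊤ g * h = X.app ⊤ h := by
  choose g hg hv hD using fun φ : M.toSuperSpace.Chart n m =>
    log_local φ (SuperSpace.res_mem (le_top : φ.dom ≤ ⊤) hh) (hu φ)
  obtain ⟨G, hG⟩ := exists_glue_dom g (by
    intro φ ψ
    have hl : M.res (inf_le_left : φ.dom ⊓ ψ.dom ≤ φ.dom) (M.res le_top h) = M.res le_top h :=
      SuperSpace.res_res _ _ _
    have hr : M.res (inf_le_right : φ.dom ⊓ ψ.dom ≤ ψ.dom) (M.res le_top h) = M.res le_top h :=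
      SuperSpace.res_res _ _ _
    refine φ.ext_val_pd inf_le_left (fun x => ?_) fun i => ?_
    · rw [φ.val_eq_val ψ inf_le_left inf_le_right (M.res inf_le_right _),
        φ.val_res le_rfl inf_le_left, ψ.val_res le_rfl inf_le_right, hv, hv,
        ← φ.val_res le_rfl inf_le_left, ← ψ.val_res le_rfl inf_le_right, hl, hr,
        φ.val_eq_val ψ inf_le_left inf_le_right]
    · have hpd := (φ.isCoordSystem
        (inf_le_left : φ.dom ⊓ ψ.dom ≤ φ.dom)).isSuperDerivation (.inr i)
      have h1 := φ.res_derivation_mul_eq (hD φ) inf_le_left hpd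
      have h2 := ψ.res_derivation_mul_eq (hD ψ) inf_le_right hpd
      rw [hl] at h1
      rw [hr, ← h1] at h2
      refine (IsUnit.mul_right_cancel ?_ h2).symm
      have := (hu φ).map (M.res (inf_le_left : φ.dom ⊓ ψ.dom ≤ φ.dom))
      rwa [hl] at this)
  refine ⟨G, mem_of_res_dom_mem fun φ => by rw [hG]; exact hg φ, fun X => ?_⟩
  refine eq_of_res_dom_eq fun φ => ?_
  have h1 := hD φ _ _ (X.isSuperDerivation φ.dom)
  rw [← hG, X.app_res, X.app_res, ← map_mul] at h1
  exact h1

/-! ### The divergence -/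

/-- The divergence `∑ ∂Q^a/∂x^a` with respect to the coordinates of a chart. -/
noncomputable def chartDiv (Q : HomologicalVectorField M.toSuperSpace)
    (φ : M.toSuperSpace.Chart n m) (W : Opens M.space) (hW : W ≤ φ.dom) : M.Fn W :=
  coordDiv (φ.coord W hW) (φ.pd W hW) (Q.app W)

variable (Q : HomologicalVectorField M.toSuperSpace)

theorem res_chartDiv (φ : M.toSuperSpace.Chart n m) {V W : Opens M.space} (hW : W ≤ φ.dom)
    (h : V ≤ W) : M.res h (chartDiv Q φ W hW) = chartDiv Q φ V (h.trans hW) := by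
  rw [chartDiv, coordDiv, map_sum]
  refine Finset.sum_congr rfl fun a _ => ?_
  rw [φ.res_pd hW h, ← Q.app_res, φ.res_coord hW h]

theorem lieCoeff_eq (s : BerezinForm M) (φ : M.toSuperSpace.Chart n m) :
    lieCoeff Q.toVectorField s φ = chartDiv Q φ φ.dom le_rfl * s.coeff φ +
      Q.app φ.dom (s.coeff φ) := by
  rw [chartDiv, ← (φ.isCoordSystem le_rfl).sum_pd_mul (Q.isSuperDerivation φ.dom), lieCoeff]
  refine Finset.sum_congr rfl fun a _ => ?_
  rw [(by decide : (1 + 1 : ZMod 2) = 0), mul_zero, uzpow_zero, one_smul]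

/-- In dρ + Q(ρ), the term produced by Q acting on the Berezinian is exactly the change of d between
the two charts. -/
theorem lieCoeff_transform (s : BerezinForm M) (φ ψ : M.toSuperSpace.Chart n m) :
    M.res (inf_le_left : φ.dom ⊓ ψ.dom ≤ φ.dom) (lieCoeff Q.toVectorField s φ) =
      M.berezinian (φ.jacobian ψ) *
        M.res (inf_le_right : φ.dom ⊓ ψ.dom ≤ ψ.dom) (lieCoeff Q.toVectorField s ψ) := by
  set W := φ.dom ⊓ ψ.dom
  have hφ : W ≤ φ.dom := inf_le_left
  have hψ : W ≤ ψ.dom := inf_le_right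
  have hc := M.isSuperComm W
  have hQ := Q.isSuperDerivation W
  have cφ := φ.isCoordSystem hφ
  have cψ := ψ.isCoordSystem hψ
  have hB0 := M.berezinian_mem (φ.jacobian ψ)
  -- The chain rule makes the Jacobian of the inverse change of coordinates a left inverse of the
  -- Jacobian.
  have hKJ : (Matrix.of fun a b => ψ.pd W hψ a (φ.coord W hφ b)) * φ.jacobian ψ = 1 := by
    ext a b
    rw [Matrix.mul_apply, Matrix.one_apply]
    exact cψ.sum_jacobian_mul cφ a b
  have hQB := (M.isEvenPart W).deriv_ber hc hQ (J := φ.jacobian ψ)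
    (K := Matrix.of fun a b => ψ.pd W hψ a (φ.coord W hφ b))
    (cφ.jacobian_mem cψ) (cψ.jacobian_mem cφ) hKJ
  have hdiv := cφ.coordDiv_eq cψ hc hQ
  change Q.app W (M.berezinian (φ.jacobian ψ)) = M.berezinian (φ.jacobian ψ) *
    ∑ b, ∑ c, ((-1 : ℤˣ) ^ (parity c)) •
      (ψ.pd W hψ b (φ.coord W hφ c) * Q.app W (φ.pd W hφ c (ψ.coord W hψ b))) at hQB
  rw [lieCoeff_eq, lieCoeff_eq, map_add, map_add, map_mul, map_mul, res_chartDiv, res_chartDiv,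
    ← Q.app_res, ← Q.app_res, s.transform φ ψ, hQ.leibniz_zero _ hB0, hQB]
  rw [chartDiv, chartDiv, hdiv, ← mul_assoc, ← (hc.commute_all hB0 _).eq]
  noncomm_ring

theorem isDivergence_iff (ρ : BerezinVolume M) (f : M.Fn ⊤) :
    IsDivergence ρ Q.toVectorField f ↔
      ∀ φ, ρ.coeff φ * M.res le_top f = lieCoeff Q.toVectorField ρ.toBerezinForm φ := by
  constructor
  · rintro ⟨σ, hσ, h⟩ φ
    rw [h, hσ]
  · intro h
    exact ⟨⟨lieCoeff Q.toVectorField ρ.toBerezinForm, lieCoeff_transform Q _⟩, fun _ => rfl, h⟩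

/-- L_Q ρ and ρ acquire the same Berezinian factor on overlaps, so their quotients agree there and
glue. -/
theorem exists_isDivergence (ρ : BerezinVolume M) : ∃ f, IsDivergence ρ Q.toVectorField f := by
  choose f hf using fun φ => (ρ.isUnit φ).dvd (a := lieCoeff Q.toVectorField ρ.toBerezinForm φ)
  obtain ⟨g, hg⟩ := exists_glue_dom f (by
    intro φ ψ
    refine ((ρ.isUnit φ).map (M.res (inf_le_left : φ.dom ⊓ ψ.dom ≤ φ.dom))).mul_left_cancel ?_
    rw [← map_mul, ← hf, lieCoeff_transform, hf, map_mul, ← mul_assoc, ← ρ.transform φ ψ])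
  exact ⟨g, (isDivergence_iff Q ρ g).2 fun φ => by rw [hg, ← hf]⟩

theorem isDivergence_unique (ρ : BerezinVolume M) {f g : M.Fn ⊤}
    (hf : IsDivergence ρ Q.toVectorField f) (hg : IsDivergence ρ Q.toVectorField g) : f = g := by
  rw [isDivergence_iff] at hf hg
  refine eq_of_res_dom_eq fun φ => (ρ.isUnit φ).mul_left_cancel ?_
  rw [hf, hg]

theorem isDivergence_divergence (ρ : BerezinVolume M) :
    IsDivergence ρ Q.toVectorField (divergence ρ Q.toVectorField) :=
  Classical.epsilon_spec (exists_isDivergence Q ρ)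

theorem eq_divergence {ρ : BerezinVolume M} {f : M.Fn ⊤} (hf : IsDivergence ρ Q.toVectorField f) :
    f = divergence ρ Q.toVectorField :=
  isDivergence_unique Q ρ hf (isDivergence_divergence Q ρ)

theorem mul_res_divergence (ρ : BerezinVolume M) (φ : M.toSuperSpace.Chart n m) :
    ρ.coeff φ * M.res le_top (divergence ρ Q.toVectorField) =
      chartDiv Q φ φ.dom le_rfl * ρ.coeff φ + Q.app φ.dom (ρ.coeff φ) := by
  rw [(isDivergence_iff Q ρ _).1 (isDivergence_divergence Q ρ), lieCoeff_eq]

theorem chartDiv_mem (φ : M.toSuperSpace.Chart n m) (W : Opens M.space) (hW : W ≤ φ.dom) :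
    chartDiv Q φ W hW ∈ M.grading W 1 :=
  (φ.isCoordSystem hW).coordDiv_mem (Q.isSuperDerivation W)

theorem divergence_mem (ρ : BerezinVolume M) :
    divergence ρ Q.toVectorField ∈ M.grading ⊤ 1 := by
  refine mem_of_res_dom_mem fun φ => mem_of_mul_mem (ρ.even φ) (ρ.isUnit φ) ?_
  rw [mul_res_divergence]
  refine Submodule.add_mem _ ?_ ?_
  · have := SetLike.mul_mem_graded (chartDiv_mem Q φ φ.dom le_rfl) (ρ.even φ)
    rwa [add_zero] at this
  · have := Q.app_mem φ.dom 0 _ (ρ.even φ)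
    rwa [zero_add] at this

theorem app_divergence (ρ : BerezinVolume M) :
    Q.app ⊤ (divergence ρ Q.toVectorField) = 0 := by
  refine eq_of_res_dom_eq fun φ => ?_
  rw [← Q.app_res, map_zero]
  have hc := M.isSuperComm φ.dom
  have hQ := Q.isSuperDerivation φ.dom
  set f := M.res (le_top : φ.dom ≤ ⊤) (divergence ρ Q.toVectorField) with hf
  set d := chartDiv Q φ φ.dom le_rfl with hd
  have hQd : Q.app φ.dom d = 0 :=
    (φ.isCoordSystem le_rfl).map_coordDiv hc hQ (Q.sq_zero φ.dom)
  -- So f - d is the logarithmic derivative of ρ. Applying Q once more gives 0 = ρ(f - d)² + ρ Q(f -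
  -- d), where the square vanishes by oddness and Q(d) = 0.
  have h1 : ρ.coeff φ * (f - d) = Q.app φ.dom (ρ.coeff φ) := by
    rw [mul_sub, mul_res_divergence, (hc.commute_all (ρ.even φ) d).eq, add_sub_cancel_left]
  have hodd : f - d ∈ M.grading φ.dom 1 :=
    Submodule.sub_mem _ (SuperSpace.res_mem _ (divergence_mem Q ρ)) (chartDiv_mem Q φ _ _)
  have h2 := Q.sq_zero φ.dom (ρ.coeff φ)
  rw [← h1, hQ.leibniz_zero _ (ρ.even φ), ← h1, mul_assoc, hc.mul_self hodd, mul_zero, zero_add,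
    (ρ.isUnit φ).mul_right_eq_zero, map_sub, hQd, sub_zero] at h2
  exact h2

/-- Only Q(g)h = Q(h) matters, so this serves both h = exp(g) and g = log|h|, where h may be
negative. -/
theorem divergence_of_isMul {ρ ρ' : BerezinVolume M} {g h : M.Fn ⊤} (hh : h ∈ M.grading ⊤ 0)
    (hQ : Q.app ⊤ g * h = Q.app ⊤ h) (hρ : IsMul h ρ ρ') :
    divergence ρ' Q.toVectorField = divergence ρ Q.toVectorField + Q.app ⊤ g := by
  refine (eq_divergence Q ((isDivergence_iff Q ρ' _).2 fun φ => ?_)).symm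
  have hc := M.isSuperComm φ.dom
  have hh' : M.res (le_top : φ.dom ≤ ⊤) h ∈ M.grading φ.dom 0 := SuperSpace.res_mem _ hh
  have hQh : Q.app φ.dom (M.res (le_top : φ.dom ≤ ⊤) h) =
      M.res le_top (Q.app ⊤ g) * M.res le_top h := by
    rw [Q.app_res, ← hQ, map_mul]
  rw [lieCoeff_eq, hρ φ, (Q.isSuperDerivation φ.dom).leibniz_zero _ hh', hQh, map_add, mul_add,
    mul_assoc, mul_res_divergence, mul_add, ← mul_assoc, (hc.commute_all hh' _).eq,
    mul_assoc (M.res _ (Q.app ⊤ g)), ← (hc.commute_all ?_ (M.res _ (Q.app ⊤ g))).eq]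
  · noncomm_ring
  · have := SetLike.mul_mem_graded hh' (ρ.even φ)
    rwa [add_zero] at this

/-- Two volumes transform by the same Berezinian, so their local ratios glue; the ratio is even and
invertible because both volumes are. -/
theorem exists_isMul (ρ ρ' : BerezinVolume M) :
    ∃ h ∈ M.grading ⊤ 0, (∀ φ : M.toSuperSpace.Chart n m, IsUnit (M.res (le_top : φ.dom ≤ ⊤) h)) ∧
      IsMul h ρ ρ' := by
  choose f hf using fun φ => (ρ.isUnit φ).dvd (a := ρ'.coeff φ)
  have hc (φ : M.toSuperSpace.Chart n m) := M.isSuperComm φ.dom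
  obtain ⟨h, hh⟩ := exists_glue_dom f (by
    intro φ ψ
    refine ((ρ.isUnit φ).map (M.res (inf_le_left : φ.dom ⊓ ψ.dom ≤ φ.dom))).mul_left_cancel ?_
    rw [← map_mul, ← hf, ρ'.transform φ ψ, hf, map_mul, ← mul_assoc, ← ρ.transform φ ψ])
  refine ⟨h, mem_of_res_dom_mem fun φ => mem_of_mul_mem (ρ.even φ) (ρ.isUnit φ) ?_, fun φ => ?_,
    fun φ => ?_⟩
  · rw [hh, ← hf]; exact ρ'.even φ
  · rw [hh, ← (ρ.isUnit φ).mul_left_iff, ← hf]; exact ρ'.isUnit φ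
  · rw [hh, hf, ((hc φ).commute_all (ρ.even φ) _).eq]

theorem exists_volume_isMul (ρ : BerezinVolume M) {h : M.Fn ⊤} (hh : h ∈ M.grading ⊤ 0)
    (hu : ∀ φ : M.toSuperSpace.Chart n m, IsUnit (M.res (le_top : φ.dom ≤ ⊤) h)) :
    ∃ ρ' : BerezinVolume M, IsMul h ρ ρ' := by
  refine ⟨⟨⟨fun φ => M.res le_top h * ρ.coeff φ, fun φ ψ => ?_⟩, fun φ => ?_, fun φ => ?_⟩,
    fun φ => rfl⟩
  · have hl : M.res (inf_le_left : φ.dom ⊓ ψ.dom ≤ φ.dom) (M.res le_top h) = M.res le_top h :=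
      SuperSpace.res_res _ _ _
    have hr : M.res (inf_le_right : φ.dom ⊓ ψ.dom ≤ ψ.dom) (M.res le_top h) = M.res le_top h :=
      SuperSpace.res_res _ _ _
    rw [map_mul, map_mul, hl, hr, ρ.transform φ ψ, ← mul_assoc, ← mul_assoc,
      ((M.isSuperComm _).commute_all (M.berezinian_mem (φ.jacobian ψ)) _).eq]
  · have := SetLike.mul_mem_graded (SuperSpace.res_mem (le_top : φ.dom ≤ ⊤) hh) (ρ.even φ)
    rwa [add_zero] at this
  · exact (hu φ).mul (ρ.isUnit φ)

end Supermanifold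

end Super

/-! ### The modular class -/

open Super Super.Supermanifold in
theorem mainTheorem3 {n m : ℕ} (M : Supermanifold.{u} n m)
    (Q : HomologicalVectorField M.toSuperSpace) :
    -- the divergence exists, is unique, odd and `Q`-closed
    (∀ ρ : BerezinVolume M,
      (∀ f : M.Fn ⊤, IsDivergence ρ Q.toVectorField f ↔ f = divergence ρ Q.toVectorField) ∧
      divergence ρ Q.toVectorField ∈ M.grading ⊤ 1 ∧
      Q.app ⊤ (divergence ρ Q.toVectorField) = 0) ∧
    -- the exponential of an even function is well defined
    (∀ g ∈ M.grading ⊤ 0, ∃! h : M.Fn ⊤, IsExp g h) ∧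
    -- for `g` even, `exp(g) ρ` is a Berezin volume, and `Div_{exp(g) ρ} Q = Div_ρ Q + Q(g)`
    (∀ (ρ : BerezinVolume M) (g h : M.Fn ⊤), g ∈ M.grading ⊤ 0 → IsExp g h →
      (∃ ρ' : BerezinVolume M, IsMul h ρ ρ') ∧
      ∀ ρ' : BerezinVolume M, IsMul h ρ ρ' →
        divergence ρ' Q.toVectorField = divergence ρ Q.toVectorField + Q.app ⊤ g) ∧
    -- the modular class `Mod(Q) = [Div_ρ Q]` is well defined and independent of `ρ`
    (Nonempty (BerezinVolume M) →
      ∃! c : Q.StdCohomology 1, ∀ ρ : BerezinVolume M,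
        ∃ hρ : divergence ρ Q.toVectorField ∈ Q.cocycles 1,
          Submodule.Quotient.mk ⟨divergence ρ Q.toVectorField, hρ⟩ = c) := by
  have hcoc (ρ : BerezinVolume M) : divergence ρ Q.toVectorField ∈ Q.cocycles 1 :=
    ⟨divergence_mem Q ρ, app_divergence Q ρ⟩
  refine ⟨fun ρ => ⟨fun f => ⟨eq_divergence Q, ?_⟩, divergence_mem Q ρ, app_divergence Q ρ⟩,
    fun g hg => existsUnique_exp hg, fun ρ g h hg hgh => ?_, ?_⟩
  · rintro rfl
    exact isDivergence_divergence Q ρ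
  · have hloc (φ : M.toSuperSpace.Chart n m) :=
      exp_local φ (SuperSpace.res_mem (le_top : φ.dom ≤ ⊤) hg) (hgh φ)
    have hh : h ∈ M.grading ⊤ 0 := mem_of_res_dom_mem fun φ => (hloc φ).1
    refine ⟨exists_volume_isMul ρ hh fun φ => (hloc φ).2.1, fun ρ' hρ' =>
      divergence_of_isMul Q hh ?_ hρ'⟩
    refine eq_of_res_dom_eq fun φ => ?_
    rw [map_mul, ← Q.app_res, ← Q.app_res]
    exact (hloc φ).2.2.2 _ _ (Q.isSuperDerivation φ.dom)
  · rintro ⟨ρ₀⟩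
    refine ⟨Submodule.Quotient.mk ⟨_, hcoc ρ₀⟩, fun ρ => ⟨hcoc ρ, ?_⟩, fun c hc => ?_⟩
    · rw [Submodule.Quotient.eq]
      obtain ⟨h, hh, hu, hmul⟩ := exists_isMul ρ₀ ρ
      obtain ⟨g, hg, hQ⟩ := exists_log hh hu
      refine ⟨g, hg, ?_⟩
      change Q.app ⊤ g = divergence ρ Q.toVectorField - divergence ρ₀ Q.toVectorField
      rw [divergence_of_isMul Q hh (hQ Q.toVectorField) hmul, add_sub_cancel_left]
    · obtain ⟨_, h⟩ := hc ρ₀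
      exact h.symm
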